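/- Let $\mathbb S^2\subset\mathbb R^3$ be the unit sphere centred at the origin, with geodesic distance $\rho$, normalized spherical Lebesgue measure $\sigma_2$ and north pole $e=(1,0,0)$. Let $n\ge 3$ and let $X_1,\dots,X_{n+1}$ be independent random points on $\mathbb S^2$ with distribution $\sigma_2$. For $1\le i\le n+1$ let $$C_{i}=\{z\in\mathbb S^2:\rho(X_i,z)\le\rho(X_j,z)\text{ for all }j\in\{1,\dots,n+1\}\}$$ be the spherical Voronoi cell of $X_i$. Let $N$ be uniformly distributed on $\{1,\dots,n+1\}$ and independent of $(X_1,\dots,X_{n+1})$, and for each $v\in\mathbb S^2$ let $O_v:\mathbb R^3\to\mathbb R^3$ be an orthogonal transformation with $O_vv=e$ whose matrix elements are Borel functions of $v$. The typical cell is the random spherical polytope $\mathscr V_{n+1,2}:=O_{X_N}C_N$. For a spherical polytope $P=C\cap\mathbb S^2$, where $C$ is the polyhedral cone spanned by $P$, let $f_k(P)$ be the number of $k$-dimensional faces of $P$, that is, of intersections of $(k+1)$-dimensional faces of $C$ with $\mathbb S^2$. Then $$\mathbb E f_0(\mathscr V_{n+1,2})=\mathbb E f_1(\mathscr V_{n+1,2})=6\cdot\frac{n-1}{n+1}.$$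 -/

import Mathlib

open MeasureTheory ProbabilityTheory
open scoped ENNReal

namespace SphericalVoronoi

/-- The ambient Euclidean space `ℝ^(d+1)`, with coordinates `x₀, …, x_d`. -/
abbrev Ambient (d : ℕ) : Type := EuclideanSpace ℝ (Fin (d + 1))

/-- The unit sphere `𝕊^d ⊂ ℝ^(d+1)`. -/
abbrev Sphere (d : ℕ) : Type := Metric.sphere (0 : Ambient d) 1

/-- The north pole `e = (1, 0, …, 0)`. -/
noncomputable def northPole (d : ℕ) : Ambient d := EuclideanSpace.single 0 1

/-- The normalized spherical Lebesgue measure `σ_d` on `𝕊^d`. -/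
noncomputable def sphereMeasure (d : ℕ) : Measure (Sphere d) :=
  ((volume : Measure (Ambient d)).toSphere Set.univ)⁻¹ • (volume : Measure (Ambient d)).toSphere

/-- The spherical Voronoi cell of the `i`-th of the points `x₁, …, x_m` of `𝕊^d`; the geodesic
distance of two points of the unit sphere is the angle between them. -/
def voronoiCell {d m : ℕ} (x : Fin m → Sphere d) (i : Fin m) : Set (Ambient d) :=
  {z | z ∈ Metric.sphere (0 : Ambient d) 1 ∧
    ∀ j, InnerProductGeometry.angle (x i : Ambient d) z ≤
      InnerProductGeometry.angle (x j : Ambient d) z}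

/-- The cell of the `i`-th point, moved by the chosen orthogonal transformation that takes the
`i`-th point to the north pole. With a uniformly chosen index `i` this is the typical cell. -/
def centredCell {d m : ℕ} (O : Sphere d → (Ambient d ≃ₗᵢ[ℝ] Ambient d))
    (x : Fin m → Sphere d) (i : Fin m) : Set (Ambient d) :=
  O (x i) '' voronoiCell x i

/-- The cone `C = {t x : t ≥ 0, x ∈ P}` spanned by a subset `P` of the sphere. For a nonempty
spherical polytope `P` it is the polyhedral cone with `P = C ∩ 𝕊^d`. -/
def coneOver {d : ℕ} (P : Set (Ambient d)) : Set (Ambient d) :=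
  {y | ∃ t : ℝ, 0 ≤ t ∧ ∃ x ∈ P, y = t • x}

/-- The set of `k`-dimensional faces of a spherical polytope `P`: the intersections with `𝕊^d` of
the `(k+1)`-dimensional faces of the cone over `P`. Faces of a cone are the cone itself and its
nonempty intersections with supporting hyperplanes; the dimension is that of the affine hull. -/
def faces {d : ℕ} (k : ℕ) (P : Set (Ambient d)) : Set (Set (Ambient d)) :=
  {F | ∃ G : Set (Ambient d), G.Nonempty ∧ IsExposed ℝ (coneOver P) G ∧
    Module.finrank ℝ (vectorSpan ℝ G) = k + 1 ∧ F = G ∩ Metric.sphere (0 : Ambient d) 1}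

/-- `f_k(P)`, the number of `k`-dimensional faces of the spherical polytope `P`. -/
noncomputable def faceCount {d : ℕ} (k : ℕ) (P : Set (Ambient d)) : ℕ∞ := (faces k P).encard

end SphericalVoronoi

/-! On the unit sphere, the angle to `x i` is least exactly when the inner product with `x i` is
greatest. So the cone over the Voronoi cell of `x i` is the normal cone at `x i` of the convex hull
of all the points (`coneOver_voronoiCell`). Almost surely no four points satisfy a common nontrivial
affine equation (`ae_generalPosition`). Then the rays of the normal cone are the triangular facets
of the hull at `x i`, and its two-dimensional faces are the edges there
(`GeneralPosition.faceCount_eq`). At each vertex a facet has two edges and an edge lies on two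
facets, so both face numbers of the cell equal the number of facets at `x i`, which is half of
`facetPairCount`.

It remains to count the facets of the hull of `m = n + 1` points, which is done by a sweep in a
generic direction `u` instead of Euler's formula. Every triangle has a unique vertex of middle
height. Conversely, the horizontal plane through a point that is neither lowest nor highest cuts the
hull in a convex polygon with that point as a vertex, and the two polygon edges there come from the
two facets in which the point is in the middle. This gives `2 (m - 2)` facets, so the numbers of
facets at the points sum to `6 (m - 2) = 6 (n - 1)` for every configuration in general position
(`GeneralPosition.sum_facetPairCount`). Averaging over the uniform index divides by `n + 1`.

Both local counts, at an edge and at a middle vertex, reduce to a planar fact: a pointed planar cone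
has two boundary rays (`card_extremal_slopes`). -/

namespace SphericalVoronoi

open scoped RealInnerProductSpace Pointwise

/-! ### Extremal slopes -/

/-- In a finite family of vectors `(s p, r p)` of the open half plane `s > 0`, exactly two lie on
the boundary of a half plane containing the family, provided no two do so at the same time. -/
theorem card_extremal_slopes {κ : Type*} [DecidableEq κ] (I : Finset κ) (hI : 1 < I.card)
    (s r : κ → ℝ) (hs : ∀ p ∈ I, 0 < s p) (Q : κ → Prop) [DecidablePred Q]
    (hQ : ∀ p ∈ I, Q p ↔ ∃ a b : ℝ, (a ≠ 0 ∨ b ≠ 0) ∧ (∀ q ∈ I, 0 ≤ a * s q + b * r q) ∧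
      a * s p + b * r p = 0)
    (huniq : ∀ a b : ℝ, (a ≠ 0 ∨ b ≠ 0) → (∀ q ∈ I, 0 ≤ a * s q + b * r q) →
      ∀ p ∈ I, ∀ p' ∈ I, a * s p + b * r p = 0 → a * s p' + b * r p' = 0 → p = p') :
    (I.filter Q).card = 2 := by
  have hne : I.Nonempty := Finset.card_pos.1 (by omega)
  -- As `s > 0`, the boundary vectors are those of least and of greatest slope `r / s`.
  obtain ⟨p₁, hp₁, hmin⟩ := I.exists_min_image (fun p => r p / s p) hne
  obtain ⟨p₂, hp₂, hmax⟩ := I.exists_max_image (fun p => r p / s p) hne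
  have hlow : ∀ q ∈ I, 0 ≤ -(r p₁ / s p₁) * s q + 1 * r q := fun q hq => by
    have := (div_le_div_iff₀ (hs _ hp₁) (hs _ hq)).1 (hmin q hq)
    have h1 := hs _ hp₁
    have : -(r p₁ / s p₁) * s q + 1 * r q = (r q * s p₁ - r p₁ * s q) / s p₁ := by
      field_simp; ring
    rw [this]
    apply div_nonneg _ h1.le
    linarith
  have hhigh : ∀ q ∈ I, 0 ≤ (r p₂ / s p₂) * s q + (-1) * r q := fun q hq => by
    have := (div_le_div_iff₀ (hs _ hq) (hs _ hp₂)).1 (hmax q hq)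
    have h1 := hs _ hp₂
    have : (r p₂ / s p₂) * s q + (-1) * r q = (r p₂ * s q - r q * s p₂) / s p₂ := by
      field_simp; ring
    rw [this]
    apply div_nonneg _ h1.le
    linarith
  have hlow₁ : -(r p₁ / s p₁) * s p₁ + 1 * r p₁ = 0 := by
    have := (hs _ hp₁).ne'
    field_simp; ring
  have hhigh₂ : (r p₂ / s p₂) * s p₂ + (-1) * r p₂ = 0 := by
    have := (hs _ hp₂).ne'
    field_simp; ring
  -- If the extreme slopes agreed, all vectors would be parallel, and one functional would vanish at
  -- two indices.
  have hne₁₂ : p₁ ≠ p₂ := by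
    rintro rfl
    obtain ⟨q, hq, hqp⟩ := Finset.exists_mem_ne hI p₁
    have h1 := hlow q hq
    have h2 := hhigh q hq
    exact hqp (huniq _ _ (Or.inr one_ne_zero) hlow q hq p₁ hp₁ (by linarith) hlow₁)
  have : I.filter Q = {p₁, p₂} := by
    ext p
    simp only [Finset.mem_filter, Finset.mem_insert, Finset.mem_singleton]
    constructor
    · rintro ⟨hp, hQp⟩
      obtain ⟨a, b, hab, hnn, h0⟩ := (hQ p hp).1 hQp
      have hsp := hs p hp
      -- After division by `s`, the functional is `a + b * slope`. If it is nonnegative on `I` and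
      -- zero at `p`, it also vanishes at the greatest slope for `b < 0` and at the least slope for
      -- `b > 0`, so `huniq` identifies `p`.
      rcases lt_trichotomy b 0 with hb | rfl | hb
      · right
        refine huniq a b hab hnn p hp p₂ hp₂ h0 (le_antisymm ?_ (hnn _ hp₂))
        have h2 := hhigh p hp
        have hs₂ := hs _ hp₂
        have hr : r p₂ = (r p₂ / s p₂) * s p₂ := by field_simp
        set t := r p₂ / s p₂
        have : s p * (a * s p₂ + b * r p₂) = b * s p₂ * (t * s p - r p) := by
          rw [hr]; linear_combination s p₂ * h0
        have h3 : s p * (a * s p₂ + b * r p₂) ≤ 0 := by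
          rw [this]
          exact mul_nonpos_of_nonpos_of_nonneg (mul_nonpos_of_nonpos_of_nonneg hb.le hs₂.le)
            (by linarith)
        exact nonpos_of_mul_nonpos_right h3 hsp
      · have ha : a = 0 := by simpa [hsp.ne'] using h0
        simp [ha] at hab
      · left
        refine huniq a b hab hnn p hp p₁ hp₁ h0 (le_antisymm ?_ (hnn _ hp₁))
        have h2 := hlow p hp
        have hs₁ := hs _ hp₁
        have hr : r p₁ = (r p₁ / s p₁) * s p₁ := by field_simp
        set t := r p₁ / s p₁
        have : s p * (a * s p₁ + b * r p₁) = b * s p₁ * (t * s p - r p) := by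
          rw [hr]; linear_combination s p₁ * h0
        have h3 : s p * (a * s p₁ + b * r p₁) ≤ 0 := by
          rw [this]
          exact mul_nonpos_of_nonneg_of_nonpos (mul_nonneg hb.le hs₁.le) (by linarith)
        exact nonpos_of_mul_nonpos_right h3 hsp
    · rintro (rfl | rfl)
      · exact ⟨hp₁, (hQ _ hp₁).2 ⟨_, _, Or.inr one_ne_zero, hlow, hlow₁⟩⟩
      · exact ⟨hp₂, (hQ _ hp₂).2 ⟨_, _, Or.inr (by norm_num), hhigh, hhigh₂⟩⟩
  rw [this, Finset.card_pair hne₁₂]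

/-- A small perturbation preserves finitely many strict inequalities. -/
theorem exists_pos_forall_add_mul_pos {κ : Type*} (I : Finset κ) (a b : κ → ℝ)
    (ha : ∀ p ∈ I, 0 < a p) : ∃ ε : ℝ, 0 < ε ∧ ∀ p ∈ I, 0 < a p + ε * b p := by
  have h : ∀ᶠ ε : ℝ in nhdsWithin 0 (Set.Ioi 0), ∀ p ∈ I, 0 < a p + ε * b p := by
    rw [Filter.eventually_all_finset]
    intro p hp
    have hc : Filter.Tendsto (fun ε : ℝ => a p + ε * b p) (nhdsWithin 0 (Set.Ioi 0))
        (nhds (a p + 0 * b p)) := by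
      apply Filter.Tendsto.mono_left _ nhdsWithin_le_nhds
      exact (by fun_prop : Continuous fun ε : ℝ => a p + ε * b p).tendsto 0
    exact hc.eventually (lt_mem_nhds (by simpa using ha p hp))
  obtain ⟨ε, h1, h2⟩ := (h.and self_mem_nhdsWithin).exists
  exact ⟨ε, h2, h1⟩

/-! ### Points in general position -/

section GeneralPosition

variable {E : Type*} [NormedAddCommGroup E] [InnerProductSpace ℝ E] {ι : Type*}

/-- No nonzero linear functional takes the same value at four distinct points of the family. -/
def GeneralPosition (x : ι → E) : Prop :=
  ∀ i j k l, i ≠ j → i ≠ k → i ≠ l → j ≠ k → j ≠ l → k ≠ l →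
    ∀ y, ⟪x j, y⟫ = ⟪x i, y⟫ → ⟪x k, y⟫ = ⟪x i, y⟫ → ⟪x l, y⟫ = ⟪x i, y⟫ → y = 0

/-- The normal cone at the `i`-th point of the convex hull of the family. -/
def normalCone (x : ι → E) (i : ι) : Set E := {y | ∀ j, ⟪x j, y⟫ ≤ ⟪x i, y⟫}

/-- The `i`-th, `j`-th and `k`-th points are distinct and span a supporting plane of the convex
hull of the family. -/
def IsFacet (x : ι → E) (i j k : ι) : Prop :=
  i ≠ j ∧ i ≠ k ∧ j ≠ k ∧
    ∃ y, y ≠ 0 ∧ y ∈ normalCone x i ∧ ⟪x j, y⟫ = ⟪x i, y⟫ ∧ ⟪x k, y⟫ = ⟪x i, y⟫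

theorem IsFacet.swap_right {x : ι → E} {i j k : ι} (h : IsFacet x i j k) : IsFacet x i k j := by
  obtain ⟨h1, h2, h3, y, h4, h5, h6, h7⟩ := h
  exact ⟨h2, h1, h3.symm, y, h4, h5, h7, h6⟩

theorem IsFacet.swap_left {x : ι → E} {i j k : ι} (h : IsFacet x i j k) : IsFacet x j i k := by
  obtain ⟨h1, h2, h3, y, h4, h5, h6, h7⟩ := h
  exact ⟨h1.symm, h3, h2, y, h4, fun l => (h5 l).trans h6.ge, h6.symm, h7.trans h6.symm⟩

theorem isFacet_swap_right {x : ι → E} {i j k : ι} : IsFacet x i j k ↔ IsFacet x i k j :=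
  ⟨IsFacet.swap_right, IsFacet.swap_right⟩

theorem isFacet_swap_left {x : ι → E} {i j k : ι} : IsFacet x i j k ↔ IsFacet x j i k :=
  ⟨IsFacet.swap_left, IsFacet.swap_left⟩

/-- In general position the differences to a point are dual to a basis. -/
theorem GeneralPosition.exists_inner_eq {x : ι → E} (hx : GeneralPosition x)
    (hE : Module.finrank ℝ E = 3) {i j k l : ι} (hij : i ≠ j) (hik : i ≠ k) (hil : i ≠ l)
    (hjk : j ≠ k) (hjl : j ≠ l) (hkl : k ≠ l) (a b c : ℝ) :
    ∃ y, ⟪x i - x j, y⟫ = a ∧ ⟪x i - x k, y⟫ = b ∧ ⟪x i - x l, y⟫ = c := by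
  have : FiniteDimensional ℝ E := FiniteDimensional.of_finrank_pos (by omega)
  let f : E →ₗ[ℝ] (Fin 3 → ℝ) := LinearMap.pi
    ![(innerₛₗ ℝ (x i - x j)), (innerₛₗ ℝ (x i - x k)), (innerₛₗ ℝ (x i - x l))]
  have hinj : Function.Injective f := by
    rw [← LinearMap.ker_eq_bot, LinearMap.ker_eq_bot']
    intro y hy
    have h0 := congrFun hy 0
    have h1 := congrFun hy 1
    have h2 := congrFun hy 2
    simp only [f, LinearMap.pi_apply, Matrix.cons_val, Pi.zero_apply, innerₛₗ_apply_apply,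
      inner_sub_left] at h0 h1 h2
    exact hx i j k l hij hik hil hjk hjl hkl y (by linarith) (by linarith) (by linarith)
  have hsurj : Function.Surjective f :=
    (LinearMap.injective_iff_surjective_of_finrank_eq_finrank (by simp [hE])).1 hinj
  obtain ⟨y, hy⟩ := hsurj ![a, b, c]
  have h0 := congrFun hy 0
  have h1 := congrFun hy 1
  have h2 := congrFun hy 2
  simp only [f, LinearMap.pi_apply, Matrix.cons_val, innerₛₗ_apply_apply] at h0 h1 h2
  exact ⟨y, h0, h1, h2⟩

/-- Two independent vectors of a three-dimensional space and a common normal form a basis. -/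
theorem exists_common_normal (hE : Module.finrank ℝ E = 3) {a u : E}
    (h : LinearIndependent ℝ ![a, u]) :
    ∃ c : E, ⟪c, a⟫ = 0 ∧ ⟪c, u⟫ = 0 ∧ (∀ α β γ : ℝ, α • a + β • c + γ • u = 0 → α = 0 ∧ β = 0) ∧
      ∀ y, ∃ α β γ : ℝ, y = α • a + β • c + γ • u := by
  have : FiniteDimensional ℝ E := FiniteDimensional.of_finrank_pos (by omega)
  have hdim := Submodule.finrank_add_finrank_orthogonal (Submodule.span ℝ (Set.range ![a, u]))
  rw [finrank_span_eq_card h, hE, Fintype.card_fin] at hdim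
  obtain ⟨c, hc⟩ : ∃ c : (Submodule.span ℝ (Set.range ![a, u]))ᗮ, c ≠ 0 := by
    have : Nontrivial (Submodule.span ℝ (Set.range ![a, u]))ᗮ :=
      Module.nontrivial_of_finrank_pos (R := ℝ) (by omega)
    exact exists_ne 0
  have hca : ⟪(c : E), a⟫ = 0 :=
    Submodule.inner_left_of_mem_orthogonal (Submodule.subset_span (by simp)) c.2
  have hcu : ⟪(c : E), u⟫ = 0 :=
    Submodule.inner_left_of_mem_orthogonal (Submodule.subset_span (by simp)) c.2
  have hc0 : (c : E) ≠ 0 := by simpa using hc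
  have hrel : ∀ α β γ : ℝ, α • a + β • (c : E) + γ • u = 0 → α = 0 ∧ β = 0 ∧ γ = 0 := by
    intro α β γ h0
    have hβ : β = 0 := by
      have := congrArg (fun v => ⟪(c : E), v⟫) h0
      simpa [inner_add_right, inner_smul_right, hca, hcu, hc0] using this
    have := LinearIndependent.pair_iff.1 h α γ (by simpa [hβ] using h0)
    exact ⟨this.1, hβ, this.2⟩
  have hli : LinearIndependent ℝ ![a, (c : E), u] := by
    rw [Fintype.linearIndependent_iff]
    intro g hg
    have := hrel (g 0) (g 1) (g 2) (by simpa [Fin.sum_univ_three] using hg)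
    intro i
    fin_cases i
    exacts [this.1, this.2.1, this.2.2]
  refine ⟨c, hca, hcu, fun α β γ h0 => ⟨(hrel α β γ h0).1, (hrel α β γ h0).2.1⟩, fun y => ?_⟩
  have htop := hli.span_eq_top_of_card_eq_finrank' (by simp [hE])
  have hy : y ∈ Submodule.span ℝ (Set.range ![a, (c : E), u]) := htop ▸ Submodule.mem_top
  obtain ⟨g, hg⟩ := (Submodule.mem_span_range_iff_exists_fun ℝ).1 hy
  exact ⟨g 0, g 1, g 2, by simpa [Fin.sum_univ_three] using hg.symm⟩

variable [Fintype ι] [DecidableEq ι]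

open Classical in
/-- The points other than the `i`-th one at which `y` takes the same value as at the `i`-th. -/
noncomputable def activeSet (x : ι → E) (i : ι) (y : E) : Finset ι :=
  Finset.univ.filter fun j => j ≠ i ∧ ⟪x j, y⟫ = ⟪x i, y⟫

theorem mem_activeSet {x : ι → E} {i j : ι} {y : E} :
    j ∈ activeSet x i y ↔ j ≠ i ∧ ⟪x j, y⟫ = ⟪x i, y⟫ := by
  simp [activeSet]

/-- Three active points together with the `i`-th one would be four points at the same level of `y`.
This makes all facets triangles. -/
theorem GeneralPosition.card_activeSet_le {x : ι → E} (hx : GeneralPosition x) {i : ι} {y : E}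
    (hy : y ≠ 0) : (activeSet x i y).card ≤ 2 := by
  by_contra! h
  obtain ⟨j, k, l, hj, hk, hl, hjk, hjl, hkl⟩ := Finset.two_lt_card_iff.1 h
  rw [mem_activeSet] at hj hk hl
  exact hy (hx i j k l hj.1.symm hk.1.symm hl.1.symm hjk hjl hkl y hj.2 hk.2 hl.2)


/-- In general position, an edge lies on exactly two facets. -/
theorem GeneralPosition.card_isFacet_of_edge {x : ι → E} (hx : GeneralPosition x)
    (hE : Module.finrank ℝ E = 3) (hι : 4 ≤ Fintype.card ι) {i j : ι} {z : E}
    (hz : z ∈ normalCone x i) (hact : activeSet x i z = {j})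
    [DecidablePred (IsFacet x i j)] :
    (Finset.univ.filter fun k => IsFacet x i j k).card = 2 := by
  have hj : j ≠ i ∧ ⟪x j, z⟫ = ⟪x i, z⟫ := mem_activeSet.1 (by simp [hact])
  have hothers : ∀ k, k ≠ i → k ≠ j → 0 < ⟪x i - x k, z⟫ := by
    intro k hki hkj
    rw [inner_sub_left, sub_pos]
    refine lt_of_le_of_ne (hz k) fun h => hkj ?_
    simpa [hact] using mem_activeSet.2 ⟨hki, h⟩
  set I : Finset ι := (Finset.univ.erase i).erase j with hI
  have hIcard : 1 < I.card := by
    rw [hI, Finset.card_erase_of_mem (by simp [hj.1]), Finset.card_erase_of_mem (by simp),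
      Finset.card_univ]
    omega
  have hmemI : ∀ {k}, k ∈ I ↔ k ≠ j ∧ k ≠ i := by simp [hI]
  obtain ⟨k₀, hk₀, l₀, hl₀, hkl₀⟩ := Finset.one_lt_card.1 hIcard
  rw [hmemI] at hk₀ hl₀
  have hz0 : z ≠ 0 := by
    rintro rfl
    simpa using hothers k₀ hk₀.2 hk₀.1
  set u := x i - x j with hu
  have hu0 : u ≠ 0 := by
    intro h
    obtain ⟨y, hy, -⟩ := hx.exists_inner_eq hE hj.1.symm hk₀.2.symm hl₀.2.symm hk₀.1.symm
      hl₀.1.symm hkl₀ 1 0 0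
    rw [← hu, h, inner_zero_left] at hy
    exact zero_ne_one hy
  have hzu : ⟪u, z⟫ = 0 := by rw [hu, inner_sub_left, hj.2, sub_self]
  have hli : LinearIndependent ℝ ![z, u] := by
    rw [LinearIndependent.pair_iff]
    intro a b hab
    have h1 := congrArg (fun v => ⟪u, v⟫) hab
    have hb : b = 0 := by
      simpa [inner_add_right, inner_smul_right, hzu, hu0] using h1
    subst hb
    exact ⟨by simpa [hz0] using hab, rfl⟩
  -- Normals of supporting planes through the edge are orthogonal to `u`, hence of the form `a • z +
  -- b • c`. In these coordinates `x i - x k` becomes a planar vector whose first entry is positive,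
  -- and facets through the edge correspond to its boundary half planes.
  obtain ⟨c, -, hcu, hrel, hspan⟩ := exists_common_normal hE hli
  have hcu' : ⟪u, c⟫ = 0 := by rw [real_inner_comm]; exact hcu
  have hval : ∀ (a b : ℝ) (k : ι), a * ⟪x i - x k, z⟫ + b * ⟪x i - x k, c⟫ =
      ⟪x i, a • z + b • c⟫ - ⟪x k, a • z + b • c⟫ := by
    intro a b k
    simp only [inner_sub_left, inner_add_right, inner_smul_right]; ring
  have hne : ∀ a b : ℝ, (a ≠ 0 ∨ b ≠ 0) → a • z + b • c ≠ 0 := by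
    intro a b hab h0
    obtain ⟨ha, hb⟩ := hrel a b 0 (by simpa using h0)
    simp [ha, hb] at hab
  have hju : ∀ a b : ℝ, ⟪x j, a • z + b • c⟫ = ⟪x i, a • z + b • c⟫ := by
    intro a b
    have : ⟪u, a • z + b • c⟫ = 0 := by
      simp [inner_add_right, inner_smul_right, hzu, hcu']
    rw [hu, inner_sub_left] at this
    linarith
  have hcone : ∀ a b : ℝ, (∀ q ∈ I, 0 ≤ a * ⟪x i - x q, z⟫ + b * ⟪x i - x q, c⟫) →
      a • z + b • c ∈ normalCone x i := by
    intro a b h k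
    by_cases hki : k = i
    · rw [hki]
    by_cases hkj : k = j
    · rw [hkj, hju]
    have := h k (hmemI.2 ⟨hkj, hki⟩)
    rw [hval] at this
    linarith
  have hfilter : (Finset.univ.filter fun k => IsFacet x i j k) =
      I.filter fun k => IsFacet x i j k := by
    ext k
    simp only [Finset.mem_filter, Finset.mem_univ, true_and, hmemI, iff_and_self]
    exact fun h => ⟨h.2.2.1.symm, h.2.1.symm⟩
  rw [hfilter]
  refine card_extremal_slopes I hIcard (fun k => ⟪x i - x k, z⟫) (fun k => ⟪x i - x k, c⟫)
    (fun k hk => hothers k (hmemI.1 hk).2 (hmemI.1 hk).1) _ ?_ ?_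
  · intro k hk
    rw [hmemI] at hk
    constructor
    · rintro ⟨-, -, -, y, hy0, hy, hyj, hyk⟩
      obtain ⟨a, b, g, rfl⟩ := hspan y
      have hg : g = 0 := by
        have : ⟪u, a • z + b • c + g • u⟫ = 0 := by rw [hu, inner_sub_left, ← hu, hyj, sub_self]
        simpa [inner_add_right, inner_smul_right, hzu, hcu', hu0] using this
      subst hg
      rw [zero_smul, add_zero] at hy0 hy hyk
      refine ⟨a, b, ?_, fun q _ => ?_, ?_⟩
      · by_contra! h
        simp [h.1, h.2] at hy0
      · have := hy q
        rw [hval]; linarith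
      · rw [hval, hyk, sub_self]
    · rintro ⟨a, b, hab, hnn, h0⟩
      rw [hval] at h0
      exact ⟨hj.1.symm, hk.2.symm, hk.1.symm, a • z + b • c, hne a b hab, hcone a b hnn, hju a b,
        by linarith⟩
  · intro a b hab hnn p hp p' hp' h h'
    rw [hval] at h h'
    rw [hmemI] at hp hp'
    by_contra hpp
    exact hne a b hab (hx i j p p' hj.1.symm hp.2.symm hp'.2.symm hp.1.symm hp'.1.symm hpp _
      (hju a b) (by linarith) (by linarith))

/-- In general position, every vertex of a facet lies on an edge of the facet. -/
theorem GeneralPosition.exists_activeSet_eq_singleton {x : ι → E} (hx : GeneralPosition x)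
    (hE : Module.finrank ℝ E = 3) (hι : 4 ≤ Fintype.card ι) {i j k : ι} (h : IsFacet x i j k) :
    ∃ z ∈ normalCone x i, activeSet x i z = {j} := by
  obtain ⟨hij, hik, hjk, y, hy0, hy, hyj, hyk⟩ := h
  -- The fourth index only completes the differences at `x i` to a basis, so that `w` can be
  -- prescribed.
  obtain ⟨l, hl⟩ : ∃ l, l ∉ ({i, j, k} : Finset ι) := by
    by_contra! hall
    have h1 : (Finset.univ : Finset ι).card ≤ ({i, j, k} : Finset ι).card :=
      Finset.card_le_card fun l _ => hall l
    have h2 := Finset.card_le_three (a := i) (b := j) (c := k)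
    rw [Finset.card_univ] at h1
    omega
  simp only [Finset.mem_insert, Finset.mem_singleton, not_or] at hl
  -- Tilting `y` slightly by `w` keeps `j` level with `i` and pushes `k` strictly below; the other
  -- points were strictly below already.
  obtain ⟨w, hwj, hwk, -⟩ := hx.exists_inner_eq hE hij hik (Ne.symm hl.1) hjk (Ne.symm hl.2.1)
    (Ne.symm hl.2.2) 0 1 0
  have hpos : ∀ q, q ≠ i → q ≠ j → q ≠ k → 0 < ⟪x i - x q, y⟫ := by
    intro q hqi hqj hqk
    rw [inner_sub_left, sub_pos]
    exact lt_of_le_of_ne (hy q) fun h => hy0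
      (hx i j k q hij hik hqi.symm hjk hqj.symm hqk.symm y hyj hyk h)
  obtain ⟨ε, hε, hεpos⟩ := exists_pos_forall_add_mul_pos
    (((Finset.univ.erase i).erase j).erase k) (fun q => ⟪x i - x q, y⟫) (fun q => ⟪x i - x q, w⟫)
    (fun q hq => by
      simp only [Finset.mem_erase, Finset.mem_univ, and_true] at hq
      exact hpos q hq.2.2 hq.2.1 hq.1)
  have hall : ∀ q, q ≠ i → q ≠ j → ⟪x q, y + ε • w⟫ < ⟪x i, y + ε • w⟫ := by
    intro q hqi hqj
    by_cases hqk : q = k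
    · subst hqk
      rw [inner_sub_left] at hwk
      rw [inner_add_right, inner_add_right, inner_smul_right, inner_smul_right, hyk]
      nlinarith
    · have := hεpos q (by simp [hqi, hqj, hqk])
      rw [inner_sub_left, inner_sub_left] at this
      rw [inner_add_right, inner_add_right, inner_smul_right, inner_smul_right]
      linarith
  have hj : ⟪x j, y + ε • w⟫ = ⟪x i, y + ε • w⟫ := by
    rw [inner_sub_left] at hwj
    rw [inner_add_right, inner_add_right, inner_smul_right, inner_smul_right, hyj]
    linear_combination (-ε) * hwj
  refine ⟨y + ε • w, fun q => ?_, ?_⟩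
  · by_cases hqi : q = i
    · rw [hqi]
    by_cases hqj : q = j
    · rw [hqj, hj]
    exact (hall q hqi hqj).le
  · ext q
    rw [mem_activeSet, Finset.mem_singleton]
    constructor
    · rintro ⟨hqi, hq⟩
      by_contra hqj
      exact (hall q hqi hqj).ne hq
    · rintro rfl
      exact ⟨hij.symm, hj⟩

end GeneralPosition

/-! ### Counting facets -/

section Counting

variable {E : Type*} [NormedAddCommGroup E] [InnerProductSpace ℝ E] {ι : Type*}
  [Fintype ι] [DecidableEq ι]

/-- A point that is neither lowest nor highest in the direction `u` is the middle vertex of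
exactly two facets. -/
theorem GeneralPosition.card_isFacet_of_middle {x : ι → E} (hx : GeneralPosition x)
    (hE : Module.finrank ℝ E = 3) (hι : 4 ≤ Fintype.card ι) (hnorm : ∀ i, ‖x i‖ = 1) {u : E}
    (hu : Function.Injective fun i => ⟪x i, u⟫) {i : ι}
    (hlow : ∃ j, ⟪x j, u⟫ < ⟪x i, u⟫) (hhigh : ∃ k, ⟪x i, u⟫ < ⟪x k, u⟫)
    [DecidablePred fun p : ι × ι =>
      ⟪x p.1, u⟫ < ⟪x i, u⟫ ∧ ⟪x i, u⟫ < ⟪x p.2, u⟫ ∧ IsFacet x i p.1 p.2] :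
    (Finset.univ.filter fun p : ι × ι =>
      ⟪x p.1, u⟫ < ⟪x i, u⟫ ∧ ⟪x i, u⟫ < ⟪x p.2, u⟫ ∧ IsFacet x i p.1 p.2).card = 2 := by
  classical
  have hinj : Function.Injective x := fun a b h => hu (by simp [h])
  -- Strict convexity of the sphere: each `x i` is the unique maximizer of its own functional.
  have hlt : ∀ j, j ≠ i → 0 < ⟪x i - x j, x i⟫ := by
    intro j hj
    have h1 : ⟪x j, x i⟫ < 1 :=
      (inner_lt_one_iff_real_of_norm_eq_one (hnorm j) (hnorm i)).2 fun h => hj (hinj h)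
    rw [inner_sub_left, real_inner_self_eq_norm_sq, hnorm i]
    linarith
  have hxi0 : x i ≠ 0 := by
    intro h
    simpa [h] using hnorm i
  -- If `u` were a multiple of `x i`, then `x i` would be extreme in height, or all heights would
  -- coincide.
  have hli : LinearIndependent ℝ ![x i, u] := by
    rw [LinearIndependent.pair_iff' hxi0]
    rintro t rfl
    obtain ⟨j, hj⟩ := hlow
    obtain ⟨k, hk⟩ := hhigh
    have hji : j ≠ i := fun h => by simp [h] at hj
    have hki : k ≠ i := fun h => by simp [h] at hk
    have h1 := hlt j hji
    have h2 := hlt k hki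
    rw [inner_sub_left] at h1 h2
    simp only [inner_smul_right] at hj hk
    rcases lt_trichotomy t 0 with ht | rfl | ht <;> nlinarith
  obtain ⟨c, -, -, hrel, hspan⟩ := exists_common_normal hE hli
  set Lo : Finset ι := Finset.univ.filter fun j => ⟪x j, u⟫ < ⟪x i, u⟫ with hLo
  set Hi : Finset ι := Finset.univ.filter fun k => ⟪x i, u⟫ < ⟪x k, u⟫ with hHi
  have hmemLo : ∀ {j}, j ∈ Lo ↔ ⟪x j, u⟫ < ⟪x i, u⟫ := by simp [hLo]
  have hmemHi : ∀ {j}, j ∈ Hi ↔ ⟪x i, u⟫ < ⟪x j, u⟫ := by simp [hHi]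
  have hLoi : ∀ {j}, j ∈ Lo → j ≠ i := fun h e => by simp [e, hmemLo] at h
  have hHii : ∀ {j}, j ∈ Hi → j ≠ i := fun h e => by simp [e, hmemHi] at h
  have hLoHi : ∀ {j k}, j ∈ Lo → k ∈ Hi → j ≠ k := fun h h' e => by
    rw [hmemLo] at h; rw [hmemHi, ← e] at h'; exact lt_asymm h h'
  have hcard : Lo.card + Hi.card + 1 = Fintype.card ι := by
    have hd : Disjoint Lo Hi := Finset.disjoint_left.2 fun a h h' => hLoHi h h' rfl
    have : Lo ∪ Hi = Finset.univ.erase i := by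
      ext j
      simp only [Finset.mem_union, hmemLo, hmemHi, Finset.mem_erase, Finset.mem_univ, and_true]
      exact ⟨fun h e => by simp [e] at h, fun h => lt_or_gt_of_ne fun e => h (hu e)⟩
    rw [← Finset.card_union_of_disjoint hd, this, Finset.card_erase_of_mem (by simp),
      Finset.card_univ]
    omega
  set I : Finset (ι × ι) := Lo ×ˢ Hi with hI
  -- With at least four points, one below and one above `x i`, there are at least two low-high
  -- pairs.
  have hIcard : 1 < I.card := by
    obtain ⟨j, hj⟩ := hlow
    obtain ⟨k, hk⟩ := hhigh
    have h1 : 0 < Lo.card := Finset.card_pos.2 ⟨j, hmemLo.2 hj⟩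
    have h2 : 0 < Hi.card := Finset.card_pos.2 ⟨k, hmemHi.2 hk⟩
    rw [hI, Finset.card_product]
    by_contra! h
    have h3 : Lo.card ≤ 1 := by nlinarith
    have h4 : Hi.card ≤ 1 := by nlinarith
    omega
  have hmemI : ∀ {p : ι × ι}, p ∈ I ↔ p.1 ∈ Lo ∧ p.2 ∈ Hi := by simp [hI]
  -- Up to a positive factor, `w p` is `x i` minus the point where the chord from `x p.1` to `x p.2`
  -- crosses the horizontal plane through `x i` (for `p ∈ I`).
  set w : ι × ι → E := fun p =>
    ⟪x p.2 - x i, u⟫ • (x i - x p.1) + ⟪x i - x p.1, u⟫ • (x i - x p.2) with hw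
  have hposHi : ∀ {k}, k ∈ Hi → 0 < ⟪x k - x i, u⟫ := fun h => by
    rw [inner_sub_left, sub_pos]; exact hmemHi.1 h
  have hposLo : ∀ {j}, j ∈ Lo → 0 < ⟪x i - x j, u⟫ := fun h => by
    rw [inner_sub_left, sub_pos]; exact hmemLo.1 h
  have hwinner : ∀ p y, ⟪w p, y⟫ = ⟪x p.2 - x i, u⟫ * ⟪x i - x p.1, y⟫ +
      ⟪x i - x p.1, u⟫ * ⟪x i - x p.2, y⟫ := by
    intro p y
    simp only [hw, inner_add_left, real_inner_smul_left]
  have hwu : ∀ p, ⟪w p, u⟫ = 0 := by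
    intro p
    rw [hwinner]
    simp only [inner_sub_left]
    ring
  have hwval : ∀ (a b g : ℝ) p, ⟪w p, a • x i + b • c + g • u⟫ = a * ⟪w p, x i⟫ + b * ⟪w p, c⟫ := by
    intro a b g p
    simp only [inner_add_right, inner_smul_right, hwu]
    ring
  -- A supporting line of the horizontal slice at `x i` extends to a supporting plane of the hull:
  -- the vertical component `g` is fixed by levelling `p.1` with `i`, and vanishing at `w p` then
  -- levels `p.2`.
  have hkey : ∀ a b : ℝ, (∀ q ∈ I, 0 ≤ a * ⟪w q, x i⟫ + b * ⟪w q, c⟫) → ∀ p ∈ I,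
      a * ⟪w p, x i⟫ + b * ⟪w p, c⟫ = 0 → ∃ g : ℝ, a • x i + b • c + g • u ∈ normalCone x i ∧
        ⟪x p.1, a • x i + b • c + g • u⟫ = ⟪x i, a • x i + b • c + g • u⟫ ∧
        ⟪x p.2, a • x i + b • c + g • u⟫ = ⟪x i, a • x i + b • c + g • u⟫ := by
    intro a b hnn p hp h0
    have hp' := hmemI.1 hp
    have h1 := hposLo hp'.1
    have h2 := hposHi hp'.2
    refine ⟨-⟪x i - x p.1, a • x i + b • c⟫ / ⟪x i - x p.1, u⟫, ?_⟩
    set g := -⟪x i - x p.1, a • x i + b • c⟫ / ⟪x i - x p.1, u⟫ with hg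
    set y := a • x i + b • c + g • u with hy
    have hy1 : ⟪x i - x p.1, y⟫ = 0 := by
      rw [hy, inner_add_right, inner_smul_right, hg, div_mul_cancel₀ _ h1.ne', add_neg_cancel]
    have hy2 : ⟪x i - x p.2, y⟫ = 0 := by
      have h3 := hwinner p y
      rw [hy1, mul_zero, zero_add, hy, hwval, h0] at h3
      exact (mul_eq_zero.1 h3.symm).resolve_left h1.ne'
    refine ⟨fun q => ?_, by rw [inner_sub_left] at hy1; linarith,
      by rw [inner_sub_left] at hy2; linarith⟩
    -- A low `q` is tested in the pair with `p.2`, a high one in the pair with `p.1`; the partner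
    -- contributes zero.
    rcases lt_trichotomy ⟪x q, u⟫ ⟪x i, u⟫ with hq | hq | hq
    · have hqI : (q, p.2) ∈ I := hmemI.2 ⟨hmemLo.2 hq, hp'.2⟩
      have h3 := hnn _ hqI
      rw [← hwval a b g, ← hy, hwinner] at h3
      simp only [hy2, mul_zero, add_zero] at h3
      have := nonneg_of_mul_nonneg_right h3 h2
      rw [inner_sub_left] at this
      linarith
    · rw [hu hq]
    · have hqI : (p.1, q) ∈ I := hmemI.2 ⟨hp'.1, hmemHi.2 hq⟩
      have h3 := hnn _ hqI
      rw [← hwval a b g, ← hy, hwinner] at h3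
      simp only [hy1, mul_zero, zero_add] at h3
      have := nonneg_of_mul_nonneg_right h3 h1
      rw [inner_sub_left] at this
      linarith
  have hfilter : (Finset.univ.filter fun p : ι × ι =>
      ⟪x p.1, u⟫ < ⟪x i, u⟫ ∧ ⟪x i, u⟫ < ⟪x p.2, u⟫ ∧ IsFacet x i p.1 p.2) =
      I.filter fun p => IsFacet x i p.1 p.2 := by
    ext p
    simp only [Finset.mem_filter, Finset.mem_univ, true_and, hmemI, hmemLo, hmemHi, and_assoc]
  rw [hfilter]
  refine card_extremal_slopes I hIcard (fun p => ⟪w p, x i⟫) (fun p => ⟪w p, c⟫) ?_ _ ?_ ?_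
  · intro p hp
    rw [hmemI] at hp
    rw [hwinner]
    have := hlt _ (hLoi hp.1)
    have := hlt _ (hHii hp.2)
    have := hposLo hp.1
    have := hposHi hp.2
    positivity
  · intro p hp
    have hp' := hmemI.1 hp
    constructor
    · rintro ⟨-, -, -, y, hy0, hy, hyj, hyk⟩
      obtain ⟨a, b, g, rfl⟩ := hspan y
      refine ⟨a, b, ?_, fun q hq => ?_, ?_⟩
      -- For `a = b = 0` the normal is a nonzero multiple of `u`, which separates the heights of `i`
      -- and `p.1`.
      · by_contra! h
        rw [h.1, h.2, zero_smul, zero_smul, zero_add, zero_add] at hy0 hyj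
        rw [inner_smul_right, inner_smul_right] at hyj
        have hg : g ≠ 0 := fun h => by simp [h] at hy0
        exact (hmemLo.1 hp'.1).ne (mul_left_cancel₀ hg hyj)
      · rw [hmemI] at hq
        rw [← hwval a b g, hwinner]
        refine add_nonneg (mul_nonneg (hposHi hq.2).le ?_) (mul_nonneg (hposLo hq.1).le ?_)
        · rw [inner_sub_left]; linarith [hy q.1]
        · rw [inner_sub_left]; linarith [hy q.2]
      · rw [← hwval a b g, hwinner]
        simp only [inner_sub_left _ _ (a • x i + b • c + g • u), hyj, hyk]
        ring
    · rintro ⟨a, b, hab, hnn, h0⟩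
      obtain ⟨g, hg, hg1, hg2⟩ := hkey a b hnn p hp h0
      refine ⟨(hLoi hp'.1).symm, (hHii hp'.2).symm, hLoHi hp'.1 hp'.2, _, fun h => ?_, hg, hg1, hg2⟩
      obtain ⟨ha, hb⟩ := hrel a b g h
      simp [ha, hb] at hab
  · intro a b hab hnn p hp p' hp' h h'
    obtain ⟨g, hg, hg1, hg2⟩ := hkey a b hnn p hp h
    have hy0 : a • x i + b • c + g • u ≠ 0 := fun h => by
      obtain ⟨ha, hb⟩ := hrel a b g h
      simp [ha, hb] at hab
    rw [← hwval a b g, hwinner] at h'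
    set y := a • x i + b • c + g • u
    rw [hmemI] at hp hp'
    have hn1 : 0 ≤ ⟪x i - x p'.1, y⟫ := by rw [inner_sub_left]; linarith [hg p'.1]
    have hn2 : 0 ≤ ⟪x i - x p'.2, y⟫ := by rw [inner_sub_left]; linarith [hg p'.2]
    have hp1 := hposLo hp'.1
    have hp2 := hposHi hp'.2
    -- Two nonnegative terms with positive weights sum to zero, so both points of `p'` are level
    -- with `i`; general position then forces `p' = p`.
    have he1 : ⟪x i - x p'.1, y⟫ = 0 := by
      refine le_antisymm (nonpos_of_mul_nonpos_right ?_ hp2) hn1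
      linarith [mul_nonneg hp1.le hn2]
    have he2 : ⟪x i - x p'.2, y⟫ = 0 := by
      refine le_antisymm (nonpos_of_mul_nonpos_right ?_ hp1) hn2
      linarith [mul_nonneg hp2.le hn1]
    rw [inner_sub_left] at he1 he2
    have hne := hLoHi hp.1 hp.2
    ext
    · by_contra hpp
      exact hy0 (hx i p.1 p.2 p'.1 (hLoi hp.1).symm (hHii hp.2).symm (hLoi hp'.1).symm hne hpp
        (hLoHi hp'.1 hp.2).symm y hg1 hg2 (by linarith))
    · by_contra hpp
      exact hy0 (hx i p.1 p.2 p'.2 (hLoi hp.1).symm (hHii hp.2).symm (hHii hp'.2).symm hne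
        (hLoHi hp.1 hp'.2) hpp y hg1 hg2 (by linarith))

/-- All but two elements lie strictly between two others. -/
theorem card_between_add_two {h : ι → ℝ} (hh : Function.Injective h) (hι : 2 ≤ Fintype.card ι)
    [DecidablePred fun i => (∃ j, h j < h i) ∧ ∃ k, h i < h k] :
    (Finset.univ.filter fun i => (∃ j, h j < h i) ∧ ∃ k, h i < h k).card + 2 =
      Fintype.card ι := by
  have hne : (Finset.univ : Finset ι).Nonempty := Finset.card_pos.1 (by rw [Finset.card_univ]; omega)
  obtain ⟨a, -, ha⟩ := Finset.univ.exists_min_image h hne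
  obtain ⟨b, -, hb⟩ := Finset.univ.exists_max_image h hne
  have hab : a ≠ b := by
    rintro rfl
    obtain ⟨q, -, hq⟩ := Finset.exists_mem_ne (s := Finset.univ) (by rw [Finset.card_univ]; omega) a
    exact hq (hh (le_antisymm (hb q (by simp)) (ha q (by simp))))
  have : (Finset.univ.filter fun i => (∃ j, h j < h i) ∧ ∃ k, h i < h k) = {a, b}ᶜ := by
    ext i
    simp only [Finset.mem_filter, Finset.mem_univ, true_and, Finset.mem_compl, Finset.mem_insert,
      Finset.mem_singleton, not_or]
    constructor
    · rintro ⟨⟨j, hj⟩, k, hk⟩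
      exact ⟨fun e => (ha j (by simp)).not_gt (e ▸ hj), fun e => (hb k (by simp)).not_gt (e ▸ hk)⟩
    · rintro ⟨h1, h2⟩
      exact ⟨⟨a, lt_of_le_of_ne (ha i (by simp)) fun e => h1 (hh e).symm⟩,
        ⟨b, lt_of_le_of_ne (hb i (by simp)) fun e => h2 (hh e)⟩⟩
  rw [this, Finset.card_compl, Finset.card_pair hab]
  omega

open Classical in
/-- The number of ordered pairs completing the `i`-th point to a facet. -/
noncomputable def facetPairCount (x : ι → E) (i : ι) : ℕ :=
  (Finset.univ.filter fun p : ι × ι => IsFacet x i p.1 p.2).card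

omit [DecidableEq ι] in
/-- Some direction separates finitely many distinct points. -/
theorem exists_injective_inner {x : ι → E} (hx : Function.Injective x) :
    ∃ u : E, Function.Injective fun i => ⟪x i, u⟫ := by
  obtain ⟨u, hu⟩ := Module.Dual.exists_forall_ne_zero_of_forall_exists
    (fun p : {p : ι × ι // p.1 ≠ p.2} => (innerₛₗ ℝ (x p.1.1 - x p.1.2) : Module.Dual ℝ E))
    (fun p => ⟨x p.1.1 - x p.1.2, by
      rw [innerₛₗ_apply_apply]
      exact inner_self_ne_zero.2 (sub_ne_zero.2 (hx.ne p.2))⟩)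
  refine ⟨u, fun i j h => ?_⟩
  by_contra hij
  refine hu ⟨(i, j), hij⟩ ?_
  simpa [inner_sub_left, sub_eq_zero] using h

/-- Four or more points in general position are distinct. -/
theorem GeneralPosition.injective {x : ι → E} (hx : GeneralPosition x)
    (hE : Module.finrank ℝ E = 3) (hι : 4 ≤ Fintype.card ι) : Function.Injective x := by
  intro i j hij
  by_contra hne
  obtain ⟨k, hk⟩ : ∃ k, k ∉ ({i, j} : Finset ι) := by
    by_contra! hall
    have h1 : (Finset.univ : Finset ι).card ≤ ({i, j} : Finset ι).card :=
      Finset.card_le_card fun l _ => hall l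
    have h2 := Finset.card_le_two (a := i) (b := j)
    rw [Finset.card_univ] at h1
    omega
  obtain ⟨l, hl⟩ : ∃ l, l ∉ ({i, j, k} : Finset ι) := by
    by_contra! hall
    have h1 : (Finset.univ : Finset ι).card ≤ ({i, j, k} : Finset ι).card :=
      Finset.card_le_card fun l _ => hall l
    have h2 := Finset.card_le_three (a := i) (b := j) (c := k)
    rw [Finset.card_univ] at h1
    omega
  simp only [Finset.mem_insert, Finset.mem_singleton, not_or] at hk hl
  obtain ⟨y, hy, -⟩ := hx.exists_inner_eq hE hne (Ne.symm hk.1) (Ne.symm hl.1) (Ne.symm hk.2)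
    (Ne.symm hl.2.1) (Ne.symm hl.2.2) 1 0 0
  simp [hij] at hy

/-- Points of the sphere in general position, `m ≥ 4` in number, span `2 m - 4` facets; here every
facet is counted with its six orderings. -/
theorem GeneralPosition.sum_facetPairCount {x : ι → E} (hx : GeneralPosition x)
    (hE : Module.finrank ℝ E = 3) (hι : 4 ≤ Fintype.card ι) (hnorm : ∀ i, ‖x i‖ = 1) :
    ∑ i, facetPairCount x i = 12 * (Fintype.card ι - 2) := by
  classical
  obtain ⟨u, hu⟩ := exists_injective_inner (hx.injective hE hι)
  set h : ι → ℝ := fun i => ⟪x i, u⟫ with hh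
  -- Facets listed in the order middle, low, high; each facet appears once.
  let A : ι → ι → ι → ℕ := fun i j k => if h j < h i ∧ h i < h k ∧ IsFacet x i j k then 1 else 0
  have hM : ∑ i, ∑ j, ∑ k, A i j k = 2 * (Fintype.card ι - 2) := by
    have h1 : ∀ i, ∑ j, ∑ k, A i j k =
        if (∃ j, h j < h i) ∧ ∃ k, h i < h k then 2 else 0 := by
      intro i
      rw [← Fintype.sum_prod_type' (f := A i)]
      simp only [A]
      rw [← Finset.card_filter]
      split_ifs with hi
      · exact hx.card_isFacet_of_middle hE hι hnorm hu hi.1 hi.2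
      · rw [Finset.card_eq_zero, Finset.filter_eq_empty_iff]
        rintro p - ⟨h1, h2, -⟩
        exact hi ⟨⟨_, h1⟩, ⟨_, h2⟩⟩
    rw [Finset.sum_congr rfl fun i _ => h1 i, ← Finset.sum_filter, Finset.sum_const, smul_eq_mul]
    have := card_between_add_two hu (by omega)
    omega
  -- The three heights are distinct, so exactly one of the six orderings of a facet is the one
  -- recorded by `A`. After relabelling, the six sums agree, whence `6 * 2 (m - 2)`.
  have hsplit : ∀ i j k, (if IsFacet x i j k then 1 else 0) =
      A i j k + A i k j + A j i k + A j k i + A k i j + A k j i := by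
    intro i j k
    have e1 : IsFacet x i k j ↔ IsFacet x i j k := isFacet_swap_right
    have e2 : IsFacet x j i k ↔ IsFacet x i j k := isFacet_swap_left
    have e3 : IsFacet x j k i ↔ IsFacet x i j k := isFacet_swap_right.trans e2
    have e4 : IsFacet x k i j ↔ IsFacet x i j k := isFacet_swap_left.trans e1
    have e5 : IsFacet x k j i ↔ IsFacet x i j k := isFacet_swap_right.trans e4
    simp only [A, e1, e2, e3, e4, e5]
    by_cases hF : IsFacet x i j k
    · have hij : h i ≠ h j := fun e => hF.1 (hu e)
      have hik : h i ≠ h k := fun e => hF.2.1 (hu e)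
      have hjk : h j ≠ h k := fun e => hF.2.2.1 (hu e)
      simp only [hF, and_true, if_true]
      rcases lt_or_gt_of_ne hij with a | a <;> rcases lt_or_gt_of_ne hik with b | b <;>
        rcases lt_or_gt_of_ne hjk with c | c <;>
        first
          | (exfalso; linarith)
          | simp [a, b, c, a.not_gt, b.not_gt, c.not_gt]
    · simp [hF]
  have hcount : ∀ i, facetPairCount x i = ∑ j, ∑ k, if IsFacet x i j k then 1 else 0 := by
    intro i
    rw [facetPairCount, Finset.card_filter, Fintype.sum_prod_type]
  rw [Finset.sum_congr rfl fun i _ => hcount i]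
  simp only [hsplit, Finset.sum_add_distrib]
  have s1 : ∑ i, ∑ j, ∑ k, A i k j = ∑ i, ∑ j, ∑ k, A i j k :=
    Finset.sum_congr rfl fun i _ => Finset.sum_comm
  have s2 : ∑ i, ∑ j, ∑ k, A j i k = ∑ i, ∑ j, ∑ k, A i j k := Finset.sum_comm
  have s3 : ∑ i, ∑ j, ∑ k, A j k i = ∑ i, ∑ j, ∑ k, A i j k := by
    rw [Finset.sum_comm, ← s1]
  have s4 : ∑ i, ∑ j, ∑ k, A k i j = ∑ i, ∑ j, ∑ k, A i j k := by
    rw [← s2]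
    exact Finset.sum_congr rfl fun i _ => Finset.sum_comm
  have s5 : ∑ i, ∑ j, ∑ k, A k j i = ∑ i, ∑ j, ∑ k, A i j k := by
    rw [← s4, Finset.sum_comm]
  rw [s1, s2, s3, s4, s5, hM]
  ring

/-! ### Active sets of the normal cone and their relation to facets -/

open Classical in
/-- The sets of `c` points that are active together at some nonzero vector of the normal cone at
the `i`-th point. -/
noncomputable def coneFaceSets (x : ι → E) (i : ι) (c : ℕ) : Finset (Finset ι) :=
  Finset.univ.filter fun s => s.card = c ∧ ∃ y, y ≠ 0 ∧ y ∈ normalCone x i ∧ activeSet x i y = s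

theorem mem_coneFaceSets {x : ι → E} {i : ι} {c : ℕ} {s : Finset ι} :
    s ∈ coneFaceSets x i c ↔
      s.card = c ∧ ∃ y, y ≠ 0 ∧ y ∈ normalCone x i ∧ activeSet x i y = s := by
  simp [coneFaceSets]

/-- The normal of a facet through `i`, `j`, `k` can have no further active point, so its active set
is the whole of `{j, k}`. -/
theorem GeneralPosition.isFacet_iff {x : ι → E} (hx : GeneralPosition x) {i j k : ι} (hjk : j ≠ k) :
    IsFacet x i j k ↔ {j, k} ∈ coneFaceSets x i 2 := by
  rw [mem_coneFaceSets]
  constructor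
  · rintro ⟨hij, hik, -, y, hy0, hy, hyj, hyk⟩
    refine ⟨Finset.card_pair hjk, y, hy0, hy, ?_⟩
    refine (Finset.eq_of_subset_of_card_le ?_ ?_).symm
    · intro q hq
      rw [mem_activeSet]
      rcases Finset.mem_insert.1 hq with rfl | hq
      · exact ⟨hij.symm, hyj⟩
      · rw [Finset.mem_singleton.1 hq]
        exact ⟨hik.symm, hyk⟩
    · rw [Finset.card_pair hjk]
      exact hx.card_activeSet_le hy0
  · rintro ⟨-, y, hy0, hy, hact⟩
    have hj : j ∈ activeSet x i y := by simp [hact]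
    have hk : k ∈ activeSet x i y := by simp [hact]
    rw [mem_activeSet] at hj hk
    exact ⟨hj.1.symm, hk.1.symm, hjk, y, hy0, hy, hj.2, hk.2⟩

/-- A facet at a point completes in two orders. -/
theorem GeneralPosition.facetPairCount_eq_two_mul_card_pairs {x : ι → E}
    (hx : GeneralPosition x) (i : ι) : facetPairCount x i = 2 * (coneFaceSets x i 2).card := by
  classical
  rw [facetPairCount, Finset.card_eq_sum_card_fiberwise (f := fun p : ι × ι => ({p.1, p.2} : Finset ι))
    (t := coneFaceSets x i 2), Finset.sum_congr rfl (g := fun _ => 2), Finset.sum_const, smul_eq_mul,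
    mul_comm]
  · intro s hs
    obtain ⟨a, b, hab, rfl⟩ := Finset.card_eq_two.1 (mem_coneFaceSets.1 hs).1
    have hF := (hx.isFacet_iff hab).2 hs
    have : (Finset.univ.filter fun p : ι × ι => IsFacet x i p.1 p.2).filter
        (fun p => ({p.1, p.2} : Finset ι) = {a, b}) = {(a, b), (b, a)} := by
      ext p
      simp only [Finset.mem_filter, Finset.mem_univ, true_and, Finset.mem_insert,
        Finset.mem_singleton]
      constructor
      · rintro ⟨hp, he⟩
        have h1 : p.1 ∈ ({a, b} : Finset ι) := he ▸ by simp
        have h2 : p.2 ∈ ({a, b} : Finset ι) := he ▸ by simp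
        have h3 := hp.2.2.1
        simp only [Finset.mem_insert, Finset.mem_singleton] at h1 h2
        rcases h1 with h1 | h1 <;> rcases h2 with h2 | h2
        · exact absurd (h1.trans h2.symm) h3
        · exact Or.inl (Prod.ext h1 h2)
        · exact Or.inr (Prod.ext h1 h2)
        · exact absurd (h1.trans h2.symm) h3
      · rintro (rfl | rfl)
        · exact ⟨hF, rfl⟩
        · exact ⟨hF.swap_right, Finset.pair_comm _ _⟩
    rw [this, Finset.card_pair fun h => hab (congrArg Prod.fst h)]
  · intro p hp
    have hp : IsFacet x i p.1 p.2 := by simpa using hp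
    exact (hx.isFacet_iff hp.2.2.1).1 hp

/-- Every edge at a point lies on two facets. -/
theorem GeneralPosition.facetPairCount_eq_two_mul_card_singletons {x : ι → E}
    (hx : GeneralPosition x) (hE : Module.finrank ℝ E = 3) (hι : 4 ≤ Fintype.card ι) (i : ι) :
    facetPairCount x i = 2 * (coneFaceSets x i 1).card := by
  classical
  have h1 : ∀ j, (∑ k, if IsFacet x i j k then 1 else 0) =
      if {j} ∈ coneFaceSets x i 1 then 2 else 0 := by
    intro j
    rw [← Finset.card_filter]
    split_ifs with h
    · obtain ⟨-, y, -, hy, hact⟩ := mem_coneFaceSets.1 h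
      exact hx.card_isFacet_of_edge hE hι hy hact
    · rw [Finset.card_eq_zero, Finset.filter_eq_empty_iff]
      intro k _ hk
      obtain ⟨z, hz, hact⟩ := hx.exists_activeSet_eq_singleton hE hι hk
      refine h (mem_coneFaceSets.2 ⟨Finset.card_singleton j, z, ?_, hz, hact⟩)
      rintro rfl
      have : k ∈ activeSet x i 0 := mem_activeSet.2 ⟨hk.2.1.symm, by simp⟩
      rw [hact, Finset.mem_singleton] at this
      exact hk.2.2.1 this.symm
  have h2 : (Finset.univ.filter fun j => {j} ∈ coneFaceSets x i 1).card =
      (coneFaceSets x i 1).card := by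
    refine Finset.card_bij (fun j _ => {j}) (fun j hj => by simpa using hj)
      (fun a _ b _ h => Finset.singleton_injective h) fun s hs => ?_
    obtain ⟨j, rfl⟩ := Finset.card_eq_one.1 (mem_coneFaceSets.1 hs).1
    exact ⟨j, by simpa using hs, rfl⟩
  rw [facetPairCount, Finset.card_filter, Fintype.sum_prod_type, Finset.sum_congr rfl fun j _ => h1 j,
    ← Finset.sum_filter, Finset.sum_const, smul_eq_mul, h2, mul_comm]

end Counting

/-! ### Faces of the normal cone -/

section Faces

variable {E : Type*} [NormedAddCommGroup E] [InnerProductSpace ℝ E] {ι : Type*}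

/-- The face of the normal cone cut out by equality at the points of `s`. -/
def coneFace (x : ι → E) (i : ι) (s : Finset ι) : Set E :=
  {y | y ∈ normalCone x i ∧ ∀ j ∈ s, ⟪x j, y⟫ = ⟪x i, y⟫}

/-- Each `x j - x i` is nonpositive on the normal cone, so their sum over `s` attains its maximum
`0` exactly where every term vanishes. -/
theorem isExposed_coneFace (x : ι → E) (i : ι) (s : Finset ι) :
    IsExposed ℝ (normalCone x i) (coneFace x i s) := by
  intro _
  refine ⟨innerSL ℝ (∑ j ∈ s, (x j - x i)), ?_⟩
  have hval : ∀ y, innerSL ℝ (∑ j ∈ s, (x j - x i)) y = ∑ j ∈ s, (⟪x j, y⟫ - ⟪x i, y⟫) := by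
    intro y
    simp only [innerSL_apply_apply, sum_inner, inner_sub_left]
  have hnonpos : ∀ y ∈ normalCone x i, ∀ j ∈ s, ⟪x j, y⟫ - ⟪x i, y⟫ ≤ 0 := fun y hy j _ => by
    linarith [hy j]
  ext y
  constructor
  · rintro ⟨hy, hs⟩
    refine ⟨hy, fun z hz => ?_⟩
    rw [hval, hval, Finset.sum_eq_zero (s := s) (f := fun j => ⟪x j, y⟫ - ⟪x i, y⟫) fun j hj => by
      rw [hs j hj, sub_self]]
    exact Finset.sum_nonpos (hnonpos z hz)
  · rintro ⟨hy, hmax⟩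
    have h0 := hmax 0 fun j => by simp
    rw [map_zero, hval] at h0
    have := (Finset.sum_eq_zero_iff_of_nonpos (hnonpos y hy)).1
      (le_antisymm (Finset.sum_nonpos (hnonpos y hy)) h0)
    exact ⟨hy, fun j hj => sub_eq_zero.1 (this j hj)⟩

theorem add_mem_normalCone {x : ι → E} {i : ι} {y z : E} (hy : y ∈ normalCone x i)
    (hz : z ∈ normalCone x i) : y + z ∈ normalCone x i := fun j => by
  rw [inner_add_right, inner_add_right]
  exact add_le_add (hy j) (hz j)

theorem smul_mem_normalCone {x : ι → E} {i : ι} {y : E} (hy : y ∈ normalCone x i) {t : ℝ}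
    (ht : 0 ≤ t) : t • y ∈ normalCone x i := fun j => by
  rw [inner_smul_right, inner_smul_right]
  exact mul_le_mul_of_nonneg_left (hy j) ht

theorem smul_mem_coneFace {x : ι → E} {i : ι} {s : Finset ι} {y : E} (hy : y ∈ coneFace x i s)
    {t : ℝ} (ht : 0 ≤ t) : t • y ∈ coneFace x i s :=
  ⟨smul_mem_normalCone hy.1 ht, fun j hj => by
    rw [inner_smul_right, inner_smul_right, hy.2 j hj]⟩

variable [Fintype ι] [DecidableEq ι]

theorem mem_coneFace_activeSet {x : ι → E} {i : ι} {y : E} (hy : y ∈ normalCone x i) :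
    y ∈ coneFace x i (activeSet x i y) :=
  ⟨hy, fun _ hj => (mem_activeSet.1 hj).2⟩

/-- Short steps from `y` along directions orthogonal to the active differences stay in the cone. -/
theorem exists_pos_add_smul_mem_coneFace {x : ι → E} {i : ι} {y w : E} (hy : y ∈ normalCone x i)
    (hw : ∀ j ∈ activeSet x i y, ⟪x j, w⟫ = ⟪x i, w⟫) :
    ∃ ε : ℝ, 0 < ε ∧ y + ε • w ∈ coneFace x i (activeSet x i y) := by
  obtain ⟨ε, hε, h⟩ := exists_pos_forall_add_mul_pos ((Finset.univ.erase i) \ activeSet x i y)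
    (fun j => ⟪x i - x j, y⟫) (fun j => ⟪x i - x j, w⟫) (fun j hj => by
      simp only [Finset.mem_sdiff, Finset.mem_erase, Finset.mem_univ, and_true, mem_activeSet,
        not_and] at hj
      rw [inner_sub_left, sub_pos]
      exact lt_of_le_of_ne (hy j) (hj.2 hj.1))
  have heq : ∀ j ∈ activeSet x i y, ⟪x j, y + ε • w⟫ = ⟪x i, y + ε • w⟫ := fun j hj => by
    rw [inner_add_right, inner_add_right, inner_smul_right, inner_smul_right, hw j hj,
      (mem_activeSet.1 hj).2]
  refine ⟨ε, hε, fun j => ?_, heq⟩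
  by_cases hji : j = i
  · rw [hji]
  by_cases hj : j ∈ activeSet x i y
  · exact (heq j hj).le
  have := h j (by simp [hji, hj])
  rw [inner_sub_left, inner_sub_left] at this
  rw [inner_add_right, inner_add_right, inner_smul_right, inner_smul_right]
  linarith

/-- Every exposed face of the normal cone is cut out by the active set of one of its points. -/
theorem exists_eq_coneFace_of_isExposed {x : ι → E} {i : ι} {G : Set E} (hG : G.Nonempty)
    (h : IsExposed ℝ (normalCone x i) G) :
    ∃ y ∈ normalCone x i, G = coneFace x i (activeSet x i y) := by
  obtain ⟨l, rfl⟩ := h hG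
  -- A functional with a maximum at `y` on a convex cone satisfies `l (y + z) ≤ l y`, so it is
  -- nonpositive there; the face is its zero set.
  have hnonpos : ∀ z ∈ normalCone x i, l z ≤ 0 := by
    obtain ⟨y, hy, hmax⟩ := hG
    intro z hz
    have := hmax (y + z) (add_mem_normalCone hy hz)
    rw [map_add] at this
    linarith
  have hmem : ∀ z, z ∈ {y ∈ normalCone x i | ∀ z ∈ normalCone x i, l z ≤ l y} ↔
      z ∈ normalCone x i ∧ l z = 0 := by
    intro z
    refine and_congr_right fun hz => ⟨fun h => ?_, fun h w hw => h ▸ hnonpos w hw⟩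
    have := h 0 fun j => by simp
    rw [map_zero] at this
    exact le_antisymm (hnonpos z hz) this
  -- A point of the face with fewest active points plays the role of a relative interior point.
  obtain ⟨c, ⟨y, hyG, hyc⟩, hmin⟩ := WellFounded.has_min Nat.lt_wfRel.wf
    ((fun y => (activeSet x i y).card) '' {y ∈ normalCone x i | ∀ z ∈ normalCone x i, l z ≤ l y})
    (hG.image _)
  subst hyc
  have hy := (hmem y).1 hyG
  refine ⟨y, hy.1, ?_⟩
  ext z
  rw [hmem]
  constructor
  · rintro ⟨hz, hlz⟩
    refine ⟨hz, fun j hj => ?_⟩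
    -- Adding `z` can only lose active points; by minimality it loses none, so everything active at
    -- `y` is active at `z`.
    have hsub : activeSet x i (y + z) ⊆ activeSet x i y ∩ activeSet x i z := by
      intro k hk
      rw [mem_activeSet, inner_add_right, inner_add_right] at hk
      have h1 := hy.1 k
      have h2 := hz k
      rw [Finset.mem_inter, mem_activeSet, mem_activeSet]
      exact ⟨⟨hk.1, by linarith⟩, hk.1, by linarith⟩
    have hle := hmin _ ⟨y + z, (hmem _).2 ⟨add_mem_normalCone hy.1 hz, by
      rw [map_add, hy.2, hlz, add_zero]⟩, rfl⟩
    have heq := Finset.eq_of_subset_of_card_le (hsub.trans Finset.inter_subset_left) (not_lt.1 hle)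
    rw [← heq] at hj
    exact (mem_activeSet.1 (Finset.mem_inter.1 (hsub hj)).2).2
  · rintro ⟨hz, hs⟩
    refine ⟨hz, le_antisymm (hnonpos z hz) ?_⟩
    -- A short step from `y` against `z` stays in the cone, which gives the opposite sign `0 ≤ l z`.
    obtain ⟨ε, hε, hmemε⟩ := exists_pos_add_smul_mem_coneFace (w := -z) hy.1 (fun j hj => by
      rw [inner_neg_right, inner_neg_right, hs j hj])
    have := hnonpos _ hmemε.1
    rw [map_add, hy.2, map_smul, map_neg, smul_eq_mul] at this
    have h3 : 0 ≤ ε * l z := by linarith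
    exact nonneg_of_mul_nonneg_right h3 hε

/-- Once `s` is enlarged to three indices, general position provides a vector dual to any one
difference, which reads off its coefficient in a linear relation. -/
theorem GeneralPosition.linearIndependent_sub {x : ι → E} (hx : GeneralPosition x)
    (hE : Module.finrank ℝ E = 3) (hι : 4 ≤ Fintype.card ι) {i : ι} {s : Finset ι} (hi : i ∉ s)
    (hs : s.card ≤ 2) : LinearIndependent ℝ fun j : s => x i - x j := by
  rw [Fintype.linearIndependent_iff]
  rintro g hg ⟨j, hj⟩
  obtain ⟨t, hst, hti, ht⟩ := Finset.exists_subsuperset_card_eq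
    (s := s) (t := Finset.univ.erase i) (n := 3)
    (fun k hk => Finset.mem_erase.2 ⟨fun e => hi (e ▸ hk), Finset.mem_univ k⟩) (by omega)
    (by rw [Finset.card_erase_of_mem (by simp), Finset.card_univ]; omega)
  have hte : (t.erase j).card = 2 := by rw [Finset.card_erase_of_mem (hst hj), ht]
  obtain ⟨k, l, hkl, htkl⟩ := Finset.card_eq_two.1 hte
  have hk : k ∈ t.erase j := by simp [htkl]
  have hl : l ∈ t.erase j := by simp [htkl]
  have hne : ∀ {q}, q ∈ t → i ≠ q := fun hq e => by
    have := hti hq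
    simp [← e] at this
  obtain ⟨y, hy1, hy2, hy3⟩ := hx.exists_inner_eq hE (hne (hst hj)) (hne (Finset.mem_of_mem_erase hk))
    (hne (Finset.mem_of_mem_erase hl)) (Finset.ne_of_mem_erase hk).symm
    (Finset.ne_of_mem_erase hl).symm hkl 1 0 0
  have h := congrArg (fun v => ⟪v, y⟫) hg
  simp only [sum_inner, real_inner_smul_left, inner_zero_left] at h
  rw [Finset.sum_eq_single ⟨j, hj⟩] at h
  · simpa [hy1] using h
  · rintro ⟨q, hq⟩ - hqj
    have : q ∈ t.erase j := Finset.mem_erase.2 ⟨fun e => hqj (Subtype.ext e), hst hq⟩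
    rw [htkl, Finset.mem_insert, Finset.mem_singleton] at this
    rcases this with rfl | rfl
    · simp [hy2]
    · simp [hy3]
  · simp

/-- The inactive inequalities are strict at `y`, so the face contains short steps from `y` in every
direction orthogonal to the active differences. It therefore spans the orthogonal complement of
these independent vectors. -/
theorem GeneralPosition.finrank_vectorSpan_coneFace {x : ι → E} (hx : GeneralPosition x)
    (hE : Module.finrank ℝ E = 3) (hι : 4 ≤ Fintype.card ι) {i : ι} {y : E}
    (hy : y ∈ normalCone x i) (hy0 : y ≠ 0) :
    Module.finrank ℝ (vectorSpan ℝ (coneFace x i (activeSet x i y))) +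
      (activeSet x i y).card = 3 := by
  have : FiniteDimensional ℝ E := FiniteDimensional.of_finrank_pos (by omega)
  set s := activeSet x i y with hs
  have hli := hx.linearIndependent_sub hE hι (i := i) (s := s) (by simp [hs, mem_activeSet])
    (hx.card_activeSet_le hy0)
  set V := Submodule.span ℝ (Set.range fun j : s => x i - x j) with hV
  have hmem : ∀ w, w ∈ Vᗮ ↔ ∀ j ∈ s, ⟪x j, w⟫ = ⟪x i, w⟫ := by
    intro w
    rw [hV, Submodule.mem_orthogonal]
    constructor
    · intro h j hj
      have := h _ (Submodule.subset_span ⟨⟨j, hj⟩, rfl⟩)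
      rw [inner_sub_left] at this
      linarith
    · intro h v hv
      induction hv using Submodule.span_induction with
      | mem v hv =>
        obtain ⟨⟨j, hj⟩, rfl⟩ := hv
        rw [inner_sub_left, h j hj, sub_self]
      | zero => exact inner_zero_left _
      | add v v' _ _ h h' => rw [inner_add_left, h, h', add_zero]
      | smul c v _ h => rw [real_inner_smul_left, h, mul_zero]
  have hspan : vectorSpan ℝ (coneFace x i s) = Vᗮ := by
    apply le_antisymm
    · rw [vectorSpan, Submodule.span_le]
      rintro _ ⟨a, ha, b, hb, rfl⟩
      exact Submodule.sub_mem _ ((hmem a).2 ha.2) ((hmem b).2 hb.2)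
    · intro w hw
      obtain ⟨ε, hε, h⟩ := exists_pos_add_smul_mem_coneFace hy ((hmem w).1 hw)
      have h1 := vsub_mem_vectorSpan ℝ h (mem_coneFace_activeSet hy)
      rw [vsub_eq_sub, add_sub_cancel_left] at h1
      exact (Submodule.smul_mem_iff _ hε.ne').1 h1
  have hdim := Submodule.finrank_add_finrank_orthogonal V
  rw [hV, finrank_span_eq_card hli, Fintype.card_coe, hE, ← hV] at hdim
  rw [hspan]
  omega

/-- In general position, the `k`-dimensional faces of a spherical polytope whose cone is a normal
cone correspond to the active sets with `2 - k` elements. -/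
theorem GeneralPosition.faceCount_eq {x : ι → Ambient 2} (hx : GeneralPosition x)
    (hι : 4 ≤ Fintype.card ι) {i : ι} {P : Set (Ambient 2)} (hP : coneOver P = normalCone x i)
    {k c : ℕ} (hkc : c + k = 2) : faceCount k P = (coneFaceSets x i c).card := by
  have hE : Module.finrank ℝ (Ambient 2) = 3 := by simp
  have himage : faces k P =
      (fun s => coneFace x i s ∩ Metric.sphere (0 : Ambient 2) 1) '' (coneFaceSets x i c) := by
    ext F
    simp only [faces, Set.mem_ofPred_eq, hP, Set.mem_image, Finset.mem_coe, mem_coneFaceSets]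
    constructor
    · rintro ⟨G, hG, hexp, hdim, rfl⟩
      obtain ⟨y, hy, rfl⟩ := exists_eq_coneFace_of_isExposed hG hexp
      have hy0 : y ≠ 0 := by
        rintro rfl
        -- At the apex all other points are active. There are at least three of them, too many for a
        -- nonzero vector, so this face is a single point, while dimension `k + 1` is positive.
        have : vectorSpan ℝ (coneFace x i (activeSet x i 0)) = ⊥ := by
          rw [vectorSpan_eq_bot_iff_subsingleton]
          have hzero : ∀ z ∈ coneFace x i (activeSet x i 0), z = 0 := by
            intro z hz
            by_contra hz0
            have h1 := hx.card_activeSet_le (i := i) hz0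
            have h2 : Finset.univ.erase i ⊆ activeSet x i z := fun j hj => by
              have hji := Finset.ne_of_mem_erase hj
              exact mem_activeSet.2 ⟨hji, hz.2 j (mem_activeSet.2 ⟨hji, by simp⟩)⟩
            have h3 := Finset.card_le_card h2
            rw [Finset.card_erase_of_mem (by simp), Finset.card_univ] at h3
            omega
          exact fun a ha b hb => (hzero a ha).trans (hzero b hb).symm
        rw [this, finrank_bot] at hdim
        omega
      have := hx.finrank_vectorSpan_coneFace hE hι hy hy0
      exact ⟨activeSet x i y, ⟨by omega, y, hy0, hy, rfl⟩, rfl⟩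
    · rintro ⟨s, ⟨hs, y, hy0, hy, rfl⟩, rfl⟩
      have := hx.finrank_vectorSpan_coneFace hE hι hy hy0
      exact ⟨coneFace x i (activeSet x i y), ⟨y, mem_coneFace_activeSet hy⟩,
        isExposed_coneFace x i _, by omega, rfl⟩
  -- The spherical face determines its active set: the vector `y` that realizes `s`, scaled to norm
  -- one, lies on the other face, so all of `t` is active at `y`.
  have hle : ∀ s ∈ coneFaceSets x i c, ∀ t ∈ coneFaceSets x i c,
      coneFace x i s ∩ Metric.sphere (0 : Ambient 2) 1 =
        coneFace x i t ∩ Metric.sphere (0 : Ambient 2) 1 → t ⊆ s := by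
    intro s hs t ht h
    obtain ⟨-, y, hy0, hy, rfl⟩ := mem_coneFaceSets.1 hs
    obtain ⟨-, z, -, -, rfl⟩ := mem_coneFaceSets.1 ht
    have hnorm : 0 < ‖y‖ := norm_pos_iff.2 hy0
    have h1 : ‖y‖⁻¹ • y ∈ coneFace x i (activeSet x i y) ∩ Metric.sphere (0 : Ambient 2) 1 :=
      ⟨smul_mem_coneFace (mem_coneFace_activeSet hy) (by positivity), by
        simp [norm_smul, hnorm.ne']⟩
    rw [h] at h1
    have h2 := smul_mem_coneFace h1.1 hnorm.le
    rw [smul_smul, mul_inv_cancel₀ hnorm.ne', one_smul] at h2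
    exact fun j hj => mem_activeSet.2 ⟨(mem_activeSet.1 hj).1, h2.2 j hj⟩
  rw [faceCount, himage, Set.InjOn.encard_image, Set.encard_coe_eq_coe_finsetCard]
  exact fun s hs t ht h => (hle t ht s hs h.symm).antisymm (hle s hs t ht h)

end Faces

/-! ### Voronoi cells -/

/-- For unit vectors the inner product is the cosine of the angle, and cosine is strictly decreasing
on `[0, π]`. -/
theorem mem_voronoiCell_iff {d m : ℕ} {x : Fin m → Sphere d} {i : Fin m} {z : Ambient d} :
    z ∈ voronoiCell x i ↔ ‖z‖ = 1 ∧ z ∈ normalCone (fun j => (x j : Ambient d)) i := by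
  have hn : ∀ j, ‖(x j : Ambient d)‖ = 1 := fun j => by simp
  rw [voronoiCell, Set.mem_ofPred_eq, mem_sphere_zero_iff_norm]
  refine and_congr_right fun hz => forall_congr' fun j => ?_
  rw [← InnerProductGeometry.cos_angle_mul_norm_mul_norm (x j : Ambient d) z,
    ← InnerProductGeometry.cos_angle_mul_norm_mul_norm (x i : Ambient d) z]
  simp only [hn, hz, mul_one]
  exact (Real.strictAntiOn_cos.le_iff_ge
    ⟨InnerProductGeometry.angle_nonneg _ _, InnerProductGeometry.angle_le_pi _ _⟩
    ⟨InnerProductGeometry.angle_nonneg _ _, InnerProductGeometry.angle_le_pi _ _⟩).symm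

theorem coneOver_voronoiCell {d m : ℕ} (x : Fin m → Sphere d) (i : Fin m) :
    coneOver (voronoiCell x i) = normalCone (fun j => (x j : Ambient d)) i := by
  ext y
  constructor
  · rintro ⟨t, ht, z, hz, rfl⟩
    exact smul_mem_normalCone (mem_voronoiCell_iff.1 hz).2 ht
  · intro hy
    by_cases hy0 : y = 0
    -- The apex needs a nonempty cell; `x i` belongs to its own cell.
    · refine ⟨0, le_rfl, x i, mem_voronoiCell_iff.2 ⟨by simp, fun j => ?_⟩, by simp [hy0]⟩
      refine (real_inner_le_norm _ _).trans ?_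
      simp
    · have hnorm : 0 < ‖y‖ := norm_pos_iff.2 hy0
      refine ⟨‖y‖, hnorm.le, ‖y‖⁻¹ • y, mem_voronoiCell_iff.2
        ⟨by simp [norm_smul, hnorm.ne'], smul_mem_normalCone hy (by positivity)⟩, ?_⟩
      rw [smul_smul, mul_inv_cancel₀ hnorm.ne', one_smul]

/-! ### Invariance under the centring isometry -/

section Isometry

variable {E ι : Type*} [NormedAddCommGroup E] [InnerProductSpace ℝ E]

theorem mem_normalCone_isometry_iff (L : E ≃ₗᵢ[ℝ] E) {x : ι → E} {i : ι} {y : E} :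
    L y ∈ normalCone (fun j => L (x j)) i ↔ y ∈ normalCone x i := by
  simp [normalCone]

theorem GeneralPosition.isometry {x : ι → E} (hx : GeneralPosition x) (L : E ≃ₗᵢ[ℝ] E) :
    GeneralPosition fun j => L (x j) := by
  intro i j k l h1 h2 h3 h4 h5 h6 y hj hk hl
  obtain ⟨z, rfl⟩ := L.surjective y
  simp only [LinearIsometryEquiv.inner_map_map] at hj hk hl
  rw [hx i j k l h1 h2 h3 h4 h5 h6 z hj hk hl, map_zero]

theorem isFacet_isometry_iff (L : E ≃ₗᵢ[ℝ] E) {x : ι → E} {i j k : ι} :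
    IsFacet (fun j => L (x j)) i j k ↔ IsFacet x i j k := by
  refine and_congr_right fun _ => and_congr_right fun _ => and_congr_right fun _ => ?_
  constructor
  · rintro ⟨y, hy0, hy, hj, hk⟩
    obtain ⟨z, rfl⟩ := L.surjective y
    simp only [LinearIsometryEquiv.inner_map_map] at hj hk
    exact ⟨z, by simpa using hy0, (mem_normalCone_isometry_iff L).1 hy, hj, hk⟩
  · rintro ⟨y, hy0, hy, hj, hk⟩
    exact ⟨L y, by simpa using hy0, (mem_normalCone_isometry_iff L).2 hy,
      by simpa using hj, by simpa using hk⟩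

end Isometry

/-- For points in general position, both face numbers of a centred Voronoi cell are half the number
of ordered pairs of points that complete its centre to a facet of the convex hull. -/
theorem two_mul_faceCount_centredCell {m : ℕ} (hm : 4 ≤ m)
    (O : Sphere 2 → (Ambient 2 ≃ₗᵢ[ℝ] Ambient 2)) {x : Fin m → Sphere 2}
    (hx : GeneralPosition fun j => (x j : Ambient 2)) (i : Fin m) {k : ℕ} (hk : k = 0 ∨ k = 1) :
    ∃ c : ℕ, faceCount k (centredCell O x i) = c ∧
      2 * c = facetPairCount (fun j => (x j : Ambient 2)) i := by
  set L := O (x i) with hL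
  let x' : Fin m → Sphere 2 := fun j => ⟨L (x j), by simp⟩
  have hcell : centredCell O x i = voronoiCell x' i := by
    ext y
    rw [centredCell, Set.mem_image]
    obtain ⟨z, rfl⟩ := L.surjective y
    rw [mem_voronoiCell_iff, mem_normalCone_isometry_iff L, LinearIsometryEquiv.norm_map,
      ← mem_voronoiCell_iff]
    exact L.injective.mem_set_image
  have hx' : GeneralPosition fun j => (x' j : Ambient 2) := hx.isometry L
  have hcount : facetPairCount (fun j => (x' j : Ambient 2)) i =
      facetPairCount (fun j => (x j : Ambient 2)) i := by
    classical
    exact congrArg Finset.card (Finset.filter_congr fun p _ => isFacet_isometry_iff L)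
  have hcard : 4 ≤ Fintype.card (Fin m) := by simpa using hm
  rw [hcell, ← hcount]
  rcases hk with rfl | rfl
  · exact ⟨_, hx'.faceCount_eq hcard (coneOver_voronoiCell x' i) (c := 2) rfl,
      (hx'.facetPairCount_eq_two_mul_card_pairs i).symm⟩
  · exact ⟨_, hx'.faceCount_eq hcard (coneOver_voronoiCell x' i) (c := 1) rfl,
      (hx'.facetPairCount_eq_two_mul_card_singletons (by simp) hcard i).symm⟩

/-! ### Random points are in general position -/

/-- A circular cone is a null set. -/
theorem volume_inner_eq_mul_norm {d : ℕ} (hd : 1 ≤ d) {z : Ambient d} (hz : z ≠ 0) (c : ℝ) :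
    volume {y : Ambient d | ⟪z, y⟫ = c * ‖y‖} = 0 := by
  wlog hc : 0 ≤ c generalizing z c
  · have h := this (z := -z) (neg_ne_zero.2 hz) (-c) (by linarith)
    convert h using 4
    rw [inner_neg_left, neg_mul, neg_inj]
  -- For `0 ≤ c` this open solid cone is convex. If it is nonempty, the circular cone lies in its
  -- frontier, which is null.
  set U : Set (Ambient d) := {y | c * ‖y‖ - ⟪z, y⟫ < 0} with hU
  have hcont : Continuous fun y : Ambient d => c * ‖y‖ - ⟪z, y⟫ := by fun_prop
  have hopen : IsOpen U := isOpen_lt hcont continuous_const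
  have hconv : Convex ℝ U := by
    intro a ha b hb s t hs ht hst
    simp only [hU, Set.mem_ofPred_eq] at ha hb ⊢
    have h1 : ‖s • a + t • b‖ ≤ s * ‖a‖ + t * ‖b‖ := by
      refine (norm_add_le _ _).trans_eq ?_
      rw [norm_smul_of_nonneg hs, norm_smul_of_nonneg ht]
    rw [inner_add_right, inner_smul_right, inner_smul_right]
    have h2 := mul_le_mul_of_nonneg_left h1 hc
    rcases hs.eq_or_lt with rfl | hs'
    · obtain rfl : t = 1 := by linarith
      linarith
    · nlinarith [mul_pos_of_neg_of_neg (neg_neg_of_pos hs') ha,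
        mul_nonneg_of_nonpos_of_nonpos (neg_nonpos.2 ht) hb.le]
  rcases U.eq_empty_or_nonempty with hempty | ⟨p, hp⟩
  -- An empty solid cone means `‖z‖ ≤ c`; equality in Cauchy–Schwarz then confines the circular cone
  -- to the line through `z`.
  · have hcz : ‖z‖ ≤ c := by
      have h1 : z ∉ U := by simp [hempty]
      simp only [hU, Set.mem_ofPred_eq, not_lt, real_inner_self_eq_norm_sq] at h1
      have : 0 < ‖z‖ := norm_pos_iff.2 hz
      nlinarith
    refine measure_mono_null (t := (Submodule.span ℝ {z} : Set (Ambient d))) ?_ ?_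
    · intro y hy
      simp only [Set.mem_ofPred_eq] at hy
      have h1 : ⟪z, y⟫ = ‖z‖ * ‖y‖ := by
        refine le_antisymm (real_inner_le_norm _ _) ?_
        rw [hy]
        exact mul_le_mul_of_nonneg_right hcz (norm_nonneg y)
      rw [inner_eq_norm_mul_iff_real] at h1
      refine Submodule.mem_span_singleton.2 ⟨‖z‖⁻¹ * ‖y‖, ?_⟩
      rw [mul_smul, h1, smul_smul, inv_mul_cancel₀ (norm_ne_zero_iff.2 hz), one_smul]
    · refine Measure.addHaar_submodule _ _ fun htop => ?_
      have := finrank_span_singleton (K := ℝ) hz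
      rw [htop, finrank_top] at this
      simp at this
      omega
  · refine measure_mono_null ?_ (hconv.addHaar_frontier volume)
    intro y hy
    simp only [Set.mem_ofPred_eq] at hy
    rw [hopen.frontier_eq]
    refine ⟨?_, by simp [hU, hy]⟩
    have hlim : Filter.Tendsto (fun ε : ℝ => y + ε • p) (nhdsWithin 0 (Set.Ioi 0)) (nhds y) := by
      have : Continuous fun ε : ℝ => y + ε • p := by fun_prop
      simpa using (this.tendsto 0).mono_left (nhdsWithin_le_nhds (s := Set.Ioi (0 : ℝ)))
    refine mem_closure_of_tendsto hlim ?_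
    filter_upwards [self_mem_nhdsWithin] with ε hε
    have hε : 0 < ε := hε
    simp only [hU, Set.mem_ofPred_eq] at hp ⊢
    have h1 : ‖y + ε • p‖ ≤ ‖y‖ + ε * ‖p‖ := by
      refine (norm_add_le _ _).trans_eq ?_
      rw [norm_smul_of_nonneg hε.le]
    have h2 := mul_le_mul_of_nonneg_left h1 hc
    rw [inner_add_right, inner_smul_right, hy]
    nlinarith

/-- A plane section of the sphere is a null set. -/
theorem sphereMeasure_inner_eq {d : ℕ} (hd : 1 ≤ d) {z : Ambient d} (hz : z ≠ 0) (c : ℝ) :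
    sphereMeasure d {v | ⟪z, (v : Ambient d)⟫ = c} = 0 := by
  have hmeas : MeasurableSet {v : Sphere d | ⟪z, (v : Ambient d)⟫ = c} :=
    (isClosed_eq (by fun_prop) continuous_const).measurableSet
  rw [sphereMeasure, Measure.smul_apply, Measure.toSphere_apply' _ hmeas]
  -- `toSphere` measures the truncated cone over a set, and the cone over a plane section lies in a
  -- circular cone.
  have : volume (Set.Ioo (0 : ℝ) 1 • ((↑) '' {v : Sphere d | ⟪z, (v : Ambient d)⟫ = c} :
      Set (Ambient d))) = 0 := by
    refine measure_mono_null ?_ (volume_inner_eq_mul_norm hd hz c)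
    rintro _ ⟨t, ht, _, ⟨v, hv, rfl⟩, rfl⟩
    simp only [Set.mem_ofPred_eq] at hv ⊢
    have hn : ‖(v : Ambient d)‖ = 1 := by simp
    simp only [inner_smul_right, hv, norm_smul_of_nonneg ht.1.le, hn]
    ring
  rw [this, mul_zero, smul_zero]

theorem sphereMeasure_singleton {d : ℕ} (hd : 1 ≤ d) (v : Sphere d) :
    sphereMeasure d {v} = 0 := by
  refine measure_mono_null ?_ (sphereMeasure_inner_eq hd (z := v)
    (fun h => by simpa [h] using norm_eq_of_mem_sphere v) 1)
  rintro _ rfl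
  simp

/-- Three distinct points of the unit sphere are not collinear. -/
theorem linearIndependent_sub_sphere {d : ℕ} {a b c : Sphere d} (hab : a ≠ b) (hac : a ≠ c)
    (hbc : b ≠ c) :
    LinearIndependent ℝ ![(a : Ambient d) - b, (a : Ambient d) - c] := by
  have hab' : (a : Ambient d) - b ≠ 0 := sub_ne_zero.2 fun h => hab (Subtype.ext h)
  have hac' : (a : Ambient d) - c ≠ 0 := sub_ne_zero.2 fun h => hac (Subtype.ext h)
  rw [LinearIndependent.pair_iff' hab']
  intro t ht
  -- If `a - c = t • (a - b)`, this identity for `b` and `c` gives `t = t ^ 2`, so a line cannot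
  -- meet the sphere in a third point.
  have key : ∀ p : Sphere d, 2 * ⟪(a : Ambient d) - p, (a : Ambient d)⟫ =
      ‖(a : Ambient d) - p‖ ^ 2 := by
    intro p
    have ha : ‖(a : Ambient d)‖ = 1 := by simp
    have hp : ‖(p : Ambient d)‖ = 1 := by simp
    rw [norm_sub_sq_real, ha, hp, inner_sub_left, real_inner_self_eq_norm_sq, ha,
      real_inner_comm (a : Ambient d) (p : Ambient d)]
    ring
  have h1 := key b
  have h2 := key c
  rw [← ht, real_inner_smul_left, norm_smul, mul_pow, Real.norm_eq_abs, sq_abs] at h2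
  have h3 : t * (t - 1) * ‖(a : Ambient d) - b‖ ^ 2 = 0 := by
    linear_combination t * h1 - h2
  have hn : ‖(a : Ambient d) - b‖ ≠ 0 := norm_ne_zero_iff.2 hab'
  rcases mul_eq_zero.1 ((mul_eq_zero.1 h3).resolve_right (pow_ne_zero 2 hn)) with h | h
  · rw [h, zero_smul] at ht
    exact hac' ht.symm
  · rw [sub_eq_zero.1 h, one_smul] at ht
    exact hbc (Subtype.ext (sub_right_injective ht))

/-- The fourth points in a common plane with three distinct points form a null set. -/
theorem sphereMeasure_coplanar {a b c : Sphere 2} (hab : a ≠ b) (hac : a ≠ c) (hbc : b ≠ c) :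
    sphereMeasure 2 {v | ∃ y : Sphere 2, ⟪(b : Ambient 2), (y : Ambient 2)⟫ = ⟪(a : Ambient 2), y⟫ ∧
      ⟪(c : Ambient 2), (y : Ambient 2)⟫ = ⟪(a : Ambient 2), (y : Ambient 2)⟫ ∧
      ⟪(v : Ambient 2), (y : Ambient 2)⟫ = ⟪(a : Ambient 2), (y : Ambient 2)⟫} = 0 := by
  obtain ⟨w, hwb, hwc, hrel, hspan⟩ :=
    exists_common_normal (by simp) (linearIndependent_sub_sphere hab hac hbc)
  have hw0 : w ≠ 0 := fun h => by simpa using (hrel 0 1 0 (by simp [h])).2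
  refine measure_mono_null ?_ (sphereMeasure_inner_eq (by norm_num) hw0 ⟪w, (a : Ambient 2)⟫)
  rintro v ⟨y, hb, hc, hv⟩
  obtain ⟨α, β, γ, hy⟩ := hspan y
  set p := α • ((a : Ambient 2) - b) + γ • ((a : Ambient 2) - c) with hp
  have hyp : (y : Ambient 2) = p + β • w := by rw [hy, hp]; abel
  have hpw : ⟪p, w⟫ = 0 := by
    rw [real_inner_comm, hp, inner_add_right, inner_smul_right, inner_smul_right, hwb, hwc]
    ring
  have hpy : ⟪p, (y : Ambient 2)⟫ = 0 := by
    rw [hp, inner_add_left, real_inner_smul_left, real_inner_smul_left, inner_sub_left,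
      inner_sub_left, hb, hc]
    ring
  -- The component of `y` in the plane of the differences is orthogonal to itself, so `y` is a
  -- multiple of `w` and `v` lies in the fixed plane through `a` with normal `w`.
  have hp0 : p = 0 := by
    rw [hyp, inner_add_right, inner_smul_right, hpw, mul_zero, add_zero] at hpy
    exact inner_self_eq_zero.1 hpy
  rw [hp0, zero_add] at hyp
  have hβ : β ≠ 0 := by
    rintro rfl
    have := norm_eq_of_mem_sphere y
    simp [hyp] at this
  rw [hyp, inner_smul_right, inner_smul_right] at hv
  have := mul_left_cancel₀ hβ hv
  rw [Set.mem_ofPred_eq, real_inner_comm, this, real_inner_comm]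

/-- Normalization replaces a nonzero vector by a point of a compact space, so that the exceptional
events below become projections along a compact factor. -/
theorem exists_sphere_iff_exists_ne_zero {d : ℕ} {p : Ambient d → Prop}
    (hp : ∀ (t : ℝ) y, 0 < t → p y → p (t • y)) :
    (∃ y : Sphere d, p y) ↔ ∃ y, y ≠ 0 ∧ p y := by
  constructor
  · rintro ⟨y, hy⟩
    exact ⟨y, fun h => by simpa [h] using norm_eq_of_mem_sphere y, hy⟩
  · rintro ⟨y, hy0, hy⟩
    have hn : 0 < ‖y‖ := norm_pos_iff.2 hy0
    exact ⟨⟨‖y‖⁻¹ • y, by simp [norm_smul, hn.ne']⟩, hp _ _ (inv_pos.2 hn) hy⟩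

theorem isClosed_exists_of_compactSpace {α β : Type*} [TopologicalSpace α] [TopologicalSpace β]
    [CompactSpace β] {p : α → β → Prop} (hp : IsClosed {q : α × β | p q.1 q.2}) :
    IsClosed {a | ∃ b, p a b} := by
  convert isClosedMap_fst_of_compactSpace _ hp using 1
  ext a
  simp

section Random

variable {Ω : Type*} [MeasurableSpace Ω] {P : Measure Ω} [IsProbabilityMeasure P]

/-- An event for independent variables has probability zero if almost all its slices do. -/
theorem ae_notMem_of_indepFun {α β : Type*} [MeasurableSpace α] [MeasurableSpace β] {Y : Ω → α}
    {Z : Ω → β} (hY : Measurable Y) (hZ : Measurable Z) (h : IndepFun Y Z P) {B : Set (α × β)}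
    (hB : MeasurableSet B) (hslice : ∀ᵐ ω ∂P, P.map Z {z | (Y ω, z) ∈ B} = 0) :
    ∀ᵐ ω ∂P, (Y ω, Z ω) ∉ B := by
  have hZp : IsProbabilityMeasure (P.map Z) := Measure.isProbabilityMeasure_map hZ.aemeasurable
  have hmap := (indepFun_iff_map_prod_eq_prod_map_map hY.aemeasurable hZ.aemeasurable).1 h
  have hnull : P.map (fun ω => (Y ω, Z ω)) B = 0 := by
    rw [hmap, Measure.measure_prod_null hB]
    refine (ae_map_iff hY.aemeasurable ?_).2 hslice
    exact measurable_measure_prodMk_left hB (measurableSet_singleton 0)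
  rw [Measure.map_apply (hY.prodMk hZ) hB] at hnull
  rw [ae_iff]
  simp only [not_not]
  exact hnull

/-- The points are almost surely distinct, since singletons are null. Given three distinct points,
an independent fourth one avoids their common plane almost surely; the coplanarity event is closed,
so Fubini applies. -/
theorem ae_generalPosition {m : ℕ} {X : Fin m → Ω → Sphere 2} (hX : ∀ i, Measurable (X i))
    (hX_law : ∀ i, P.map (X i) = sphereMeasure 2) (hX_indep : iIndepFun X P) :
    ∀ᵐ ω ∂P, GeneralPosition fun i => (X i ω : Ambient 2) := by
  have hne : ∀ i j, i ≠ j → ∀ᵐ ω ∂P, X i ω ≠ X j ω := by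
    intro i j hij
    refine ae_notMem_of_indepFun (B := {p | p.1 = p.2}) (hX i) (hX j) (hX_indep.indepFun hij)
      (isClosed_eq continuous_fst continuous_snd).measurableSet (ae_of_all _ fun ω => ?_)
    rw [hX_law]
    refine measure_mono_null ?_ (sphereMeasure_singleton (by norm_num) (X i ω))
    intro v hv
    exact (show X i ω = v from hv).symm
  simp only [GeneralPosition, ae_all_iff]
  intro i j k l hij hik hil hjk hjl hkl
  have hindep : IndepFun (fun ω => (X i ω, X j ω, X k ω)) (X l) P := by
    have h := hX_indep.indepFun_finset {i, j, k} {l}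
      (by simp [hil.symm, hjl.symm, hkl.symm]) hX
    exact h.comp (φ := fun g : ({i, j, k} : Finset (Fin m)) → Sphere 2 =>
        (g ⟨i, by simp⟩, g ⟨j, by simp⟩, g ⟨k, by simp⟩))
      (ψ := fun g : ({l} : Finset (Fin m)) → Sphere 2 => g ⟨l, by simp⟩)
      (by fun_prop) (by fun_prop)
  have hclosed : IsClosed {p : (Sphere 2 × Sphere 2 × Sphere 2) × Sphere 2 | ∃ y : Sphere 2,
      ⟪(p.1.2.1 : Ambient 2), (y : Ambient 2)⟫ = ⟪(p.1.1 : Ambient 2), y⟫ ∧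
      ⟪(p.1.2.2 : Ambient 2), (y : Ambient 2)⟫ = ⟪(p.1.1 : Ambient 2), (y : Ambient 2)⟫ ∧
      ⟪(p.2 : Ambient 2), (y : Ambient 2)⟫ = ⟪(p.1.1 : Ambient 2), (y : Ambient 2)⟫} := by
    apply isClosed_exists_of_compactSpace
    exact (isClosed_eq (by fun_prop) (by fun_prop)).inter
      ((isClosed_eq (by fun_prop) (by fun_prop)).inter (isClosed_eq (by fun_prop) (by fun_prop)))
  have hnull := ae_notMem_of_indepFun (P := P) (by fun_prop) (hX l) hindep hclosed.measurableSet (by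
    filter_upwards [hne i j hij, hne i k hik, hne j k hjk] with ω h1 h2 h3
    rw [hX_law]
    exact sphereMeasure_coplanar h1 h2 h3)
  filter_upwards [hnull] with ω hω y hj hk hl
  by_contra hy0
  refine hω ((exists_sphere_iff_exists_ne_zero (p := fun z =>
    ⟪(X j ω : Ambient 2), z⟫ = ⟪(X i ω : Ambient 2), z⟫ ∧
    ⟪(X k ω : Ambient 2), z⟫ = ⟪(X i ω : Ambient 2), z⟫ ∧
    ⟪(X l ω : Ambient 2), z⟫ = ⟪(X i ω : Ambient 2), z⟫) fun t z _ hz => ?_).2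
    ⟨y, hy0, hj, hk, hl⟩)
  simp only [inner_smul_right, hz.1, hz.2.1, hz.2.2, and_self]

/-- The number of facets at a point depends measurably on the points. -/
theorem measurable_facetPairCount {m : ℕ} (i : Fin m) :
    Measurable fun x : Fin m → Sphere 2 => facetPairCount (fun j => (x j : Ambient 2)) i := by
  classical
  have hfacet : ∀ j k, MeasurableSet
      {x : Fin m → Sphere 2 | IsFacet (fun j => (x j : Ambient 2)) i j k} := by
    intro j k
    by_cases hd : i ≠ j ∧ i ≠ k ∧ j ≠ k
    swap
    · convert MeasurableSet.empty
      ext x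
      exact iff_of_false (fun h => hd ⟨h.1, h.2.1, h.2.2.1⟩) id
    have hclosed : IsClosed {x : Fin m → Sphere 2 | ∃ y : Sphere 2,
        (∀ l, ⟪(x l : Ambient 2), (y : Ambient 2)⟫ ≤ ⟪(x i : Ambient 2), (y : Ambient 2)⟫) ∧
        ⟪(x j : Ambient 2), (y : Ambient 2)⟫ = ⟪(x i : Ambient 2), (y : Ambient 2)⟫ ∧
        ⟪(x k : Ambient 2), (y : Ambient 2)⟫ = ⟪(x i : Ambient 2), (y : Ambient 2)⟫} := by
      apply isClosed_exists_of_compactSpace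
      refine IsClosed.inter ?_ ((isClosed_eq (by fun_prop) (by fun_prop)).inter
        (isClosed_eq (by fun_prop) (by fun_prop)))
      have h : ∀ l, IsClosed {q : (Fin m → Sphere 2) × Sphere 2 |
          ⟪(q.1 l : Ambient 2), (q.2 : Ambient 2)⟫ ≤ ⟪(q.1 i : Ambient 2), (q.2 : Ambient 2)⟫} :=
        fun l => isClosed_le (by fun_prop) (by fun_prop)
      have hInter := isClosed_iInter h
      rw [← Set.ofPred_forall] at hInter
      exact hInter
    convert hclosed.measurableSet using 1
    ext x
    refine Iff.trans ⟨fun h => h.2.2.2, fun h => ⟨hd.1, hd.2.1, hd.2.2, h⟩⟩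
      (exists_sphere_iff_exists_ne_zero fun t y ht hy => ?_).symm
    simp only [inner_smul_right, hy.2.1, hy.2.2, and_self, and_true]
    intro l
    rw [inner_smul_right, inner_smul_right]
    exact mul_le_mul_of_nonneg_left (hy.1 l) ht.le
  simp only [facetPairCount, Finset.card_filter]
  exact Finset.measurable_sum _ fun p _ => Measurable.ite (hfacet p.1 p.2) measurable_const
    measurable_const

/-! ### Averaging over the random index -/

omit [IsProbabilityMeasure P] in
/-- The mean of a function of a uniform index and an independent variable is the mean of the
average over the index. -/
theorem lintegral_uniform_index {α : Type*} [MeasurableSpace α] {n : ℕ} {N : Ω → Fin (n + 1)}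
    (hN : Measurable N) (hN_law : ∀ i, P (N ⁻¹' {i}) = ((n : ℝ≥0∞) + 1)⁻¹) {Y : Ω → α}
    (hY : Measurable Y) (hindep : IndepFun N Y P) {f : Fin (n + 1) → α → ℝ≥0∞}
    (hf : ∀ i, Measurable (f i)) :
    ∫⁻ ω, f (N ω) (Y ω) ∂P = ((n : ℝ≥0∞) + 1)⁻¹ * ∫⁻ ω, ∑ i, f i (Y ω) ∂P := by
  have hsplit : ∀ ω, f (N ω) (Y ω) = ∑ i, (N ⁻¹' {i}).indicator 1 ω * f i (Y ω) := by
    intro ω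
    rw [Finset.sum_eq_single (N ω)]
    · simp
    · intro i _ hi
      simp [hi.symm]
    · simp
  have hmeas : ∀ i, MeasurableSet (N ⁻¹' {i}) := fun i => hN (measurableSet_singleton i)
  simp only [hsplit]
  have hmeas' : ∀ i, Measurable fun ω => (N ⁻¹' {i}).indicator (1 : Ω → ℝ≥0∞) ω * f i (Y ω) :=
    fun i => (measurable_one.indicator (hmeas i)).mul ((hf i).comp hY)
  have hfY : ∀ i, Measurable fun ω => f i (Y ω) := fun i => (hf i).comp hY
  rw [lintegral_finsetSum _ fun i _ => hmeas' i, lintegral_finsetSum _ fun i _ => hfY i,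
    Finset.mul_sum]
  refine Finset.sum_congr rfl fun i _ => ?_
  have hi : IndepFun (fun ω => (N ⁻¹' {i}).indicator (1 : Ω → ℝ≥0∞) ω) (fun ω => f i (Y ω)) P :=
    hindep.comp (φ := ({i} : Set (Fin (n + 1))).indicator 1) (ψ := f i)
      (measurable_one.indicator (measurableSet_singleton i)) (hf i)
  have h := lintegral_mul_eq_lintegral_mul_lintegral_of_indepFun
    (measurable_one.indicator (hmeas i)) ((hf i).comp hY) hi
  simp only [Pi.mul_apply] at h
  rw [lintegral_indicator_one (hmeas i), hN_law] at h
  exact h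

/-- The mean number of vertices, or of edges, of the typical spherical Voronoi cell. -/
theorem lintegral_faceCount_typicalCell {n : ℕ} (hn : 3 ≤ n) {X : Fin (n + 1) → Ω → Sphere 2}
    (hX : ∀ i, Measurable (X i)) (hX_law : ∀ i, P.map (X i) = sphereMeasure 2)
    (hX_indep : iIndepFun X P) {N : Ω → Fin (n + 1)} (hN : Measurable N)
    (hN_law : ∀ i, P (N ⁻¹' {i}) = ((n : ℝ≥0∞) + 1)⁻¹)
    (hN_indep : IndepFun N (fun ω i => X i ω) P)
    (O : Sphere 2 → (Ambient 2 ≃ₗᵢ[ℝ] Ambient 2)) {k : ℕ} (hk : k = 0 ∨ k = 1) :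
    AEMeasurable (fun ω => (faceCount k (centredCell O (fun i => X i ω) (N ω)) : ℝ≥0∞)) P ∧
      ∫⁻ ω, (faceCount k (centredCell O (fun i => X i ω) (N ω)) : ℝ≥0∞) ∂P =
        ENNReal.ofReal (6 * (((n : ℝ) - 1) / ((n : ℝ) + 1))) := by
  -- A measurable stand-in for the face number; the two agree in general position, hence almost
  -- surely.
  obtain ⟨f, hfdef⟩ : ∃ f : Fin (n + 1) → (Fin (n + 1) → Sphere 2) → ℝ≥0∞, ∀ i x,
      f i x = (facetPairCount (fun j => (x j : Ambient 2)) i : ℝ≥0∞) / 2 := ⟨_, fun _ _ => rfl⟩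
  have hf : ∀ i, Measurable (f i) := by
    intro i
    rw [show f i = fun x => _ from funext (hfdef i)]
    exact ((measurable_from_nat (f := fun a : ℕ => (a : ℝ≥0∞))).comp
      (measurable_facetPairCount i)).div_const 2
  have hY : Measurable fun ω i => X i ω := measurable_pi_lambda _ hX
  have hgp := ae_generalPosition hX hX_law hX_indep
  have hae : (fun ω => (faceCount k (centredCell O (fun i => X i ω) (N ω)) : ℝ≥0∞)) =ᵐ[P]
      fun ω => f (N ω) (fun i => X i ω) := by
    filter_upwards [hgp] with ω hω
    obtain ⟨c, hc, hc2⟩ := two_mul_faceCount_centredCell (by omega) O (x := fun i => X i ω) hω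
      (N ω) hk
    rw [hfdef, hc, ← hc2, Nat.cast_mul, mul_comm, Nat.cast_two,
      ENNReal.mul_div_cancel_right (by norm_num) (by norm_num)]
    simp
  have hmeas : Measurable fun ω => f (N ω) (fun i => X i ω) :=
    (measurable_from_prod_countable_right (f := fun p : Fin (n + 1) × _ => f p.1 p.2) hf).comp
      (hN.prodMk hY)
  refine ⟨hmeas.aemeasurable.congr hae.symm, ?_⟩
  rw [lintegral_congr_ae hae, lintegral_uniform_index hN hN_law hY hN_indep hf]
  have hsum : ∀ᵐ ω ∂P, ∑ i, f i (fun i => X i ω) = ((6 * (n - 1) : ℕ) : ℝ≥0∞) := by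
    filter_upwards [hgp] with ω hω
    have h := hω.sum_facetPairCount (by simp) (by rw [Fintype.card_fin]; omega) (fun i => by simp)
    -- With `n + 1` points, `m - 2` is `n - 1`, and half of the ordered-pair total is `6 (n - 1)`.
    have h2 : 12 * (Fintype.card (Fin (n + 1)) - 2) = 6 * (n - 1) * 2 := by
      rw [Fintype.card_fin]; omega
    simp only [hfdef, div_eq_mul_inv, ← Finset.sum_mul]
    rw [← Nat.cast_sum, h, h2, Nat.cast_mul, Nat.cast_two, mul_assoc,
      ENNReal.mul_inv_cancel (by norm_num) (by norm_num), mul_one]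
  rw [lintegral_congr_ae hsum, lintegral_const, measure_univ, mul_one]
  have h1 : ((6 * (n - 1) : ℕ) : ℝ≥0∞) = ENNReal.ofReal (6 * ((n : ℝ) - 1)) := by
    rw [← ENNReal.ofReal_natCast]
    push_cast [Nat.cast_sub (show 1 ≤ n by omega)]
    rfl
  have h2 : (n : ℝ≥0∞) + 1 = ENNReal.ofReal ((n : ℝ) + 1) := by
    rw [ENNReal.ofReal_add (by positivity) zero_le_one, ENNReal.ofReal_natCast, ENNReal.ofReal_one]
  rw [h1, h2, ← ENNReal.ofReal_inv_of_pos (by positivity), ← ENNReal.ofReal_mul (by positivity)]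
  congr 1
  ring

end Random

end SphericalVoronoi

theorem corollary3p5 (n : ℕ) (hn : 3 ≤ n)
    {Ω : Type*} [MeasurableSpace Ω] (P : Measure Ω) [IsProbabilityMeasure P]
    -- independent uniformly distributed random points `X₁, …, X_{n+1}` on the 2-sphere
    (X : Fin (n + 1) → Ω → SphericalVoronoi.Sphere 2)
    (hX : ∀ i, Measurable (X i))
    (hX_law : ∀ i, P.map (X i) = SphericalVoronoi.sphereMeasure 2)
    (hX_indep : iIndepFun X P)
    -- a uniformly distributed random index, independent of the points
    (N : Ω → Fin (n + 1))
    (hN : Measurable N)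
    (hN_law : ∀ i, P (N ⁻¹' {i}) = ((n : ℝ≥0∞) + 1)⁻¹)
    (hN_indep : IndepFun N (fun ω i => X i ω) P)
    -- orthogonal transformations `O v` with `O v v = e` and Borel measurable matrix elements
    (O : SphericalVoronoi.Sphere 2 →
      (SphericalVoronoi.Ambient 2 ≃ₗᵢ[ℝ] SphericalVoronoi.Ambient 2))
    (hO : ∀ v, O v (v : SphericalVoronoi.Ambient 2) = SphericalVoronoi.northPole 2)
    (hO_meas : ∀ a b : Fin 3, Measurable fun v => O v (EuclideanSpace.single b (1 : ℝ)) a) :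
    -- `f₀` and `f₁` of the typical cell are random variables with the stated expectation
    (AEMeasurable (fun ω => (SphericalVoronoi.faceCount 0
        (SphericalVoronoi.centredCell O (fun i => X i ω) (N ω)) : ℝ≥0∞)) P ∧
      ∫⁻ ω, (SphericalVoronoi.faceCount 0
        (SphericalVoronoi.centredCell O (fun i => X i ω) (N ω)) : ℝ≥0∞) ∂P
        = ENNReal.ofReal (6 * (((n : ℝ) - 1) / ((n : ℝ) + 1)))) ∧
    (AEMeasurable (fun ω => (SphericalVoronoi.faceCount 1
        (SphericalVoronoi.centredCell O (fun i => X i ω) (N ω)) : ℝ≥0∞)) P ∧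
      ∫⁻ ω, (SphericalVoronoi.faceCount 1
        (SphericalVoronoi.centredCell O (fun i => X i ω) (N ω)) : ℝ≥0∞) ∂P
        = ENNReal.ofReal (6 * (((n : ℝ) - 1) / ((n : ℝ) + 1)))) := by
  exact ⟨SphericalVoronoi.lintegral_faceCount_typicalCell hn hX hX_law hX_indep hN hN_law hN_indep O
      (Or.inl rfl),
    SphericalVoronoi.lintegral_faceCount_typicalCell hn hX hX_law hX_indep hN hN_law hN_indep O
      (Or.inr rfl)⟩
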